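/- Let $a:\mathbb R^d\to[0,\infty)$ satisfy $a(-z)=a(z)$, $a\in L^1(\mathbb R^d)\cap L^\infty(\mathbb R^d)$, $\int_{\mathbb R^d}|z|^3a(z)\,dz<\infty$, and $a(z)\ge c$ for $|z|\le r_0$, with some $c,r_0>0$. Let $G,Y$ be nonempty disjoint open subsets of the torus $\mathbb T^d=\mathbb R^d/\mathbb Z^d$ with Lipschitz boundaries and $\mathbb T^d=\overline G\cup Y$, and let $Y^\sharp\subset\mathbb R^d$ be the periodic extension of $Y$. Assume that $Y^\sharp$ is unbounded and connected in the following sense: any two points $x',x''\in Y^\sharp$ are joined by a finite path $x'=x^1,\dots,x^M=x''$ in $Y^\sharp$ such that jumps by $x^j-x^{j+1}$ are possible for all $j<M$, where a jump by $z$ is possible if $\int_{|w-z|<\delta}a(w)\,dw>0$ for every $\delta>0$ (that is, $a>0$ at $z$ up to null sets). Functions on $\mathbb T^d$ are identified with $\mathbb Z^d$-periodic functions on $\mathbb R^d$, $Y$ is identified with $Y^\sharp\cap[0,1)^d$, and $\tilde a(\xi)=\sum_{n\in\mathbb Z^d}a(\xi+n)$. For $\varepsilon>0$ put $$\hat L^0_\varepsilon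 u(x)=\frac1{\varepsilon^{d+2}}\int_{\mathbb R^d}a\Big(\frac{x-y}\varepsilon\Big)\mathbf 1_{Y^\sharp}\Big(\frac x\varepsilon\Big)\mathbf 1_{Y^\sharp}\Big(\frac y\varepsilon\Big)\big(u(y)-u(x)\big)\,dy .$$ Then there exist bounded continuous periodic functions $\varphi=(\varphi_i)\in C(Y)^d$ and $\varkappa=(\varkappa_{ij})\in C(Y)^{d^2}$, and a (symmetric) positive definite matrix $\Theta\in\mathbb R^{d\times d}$, such that for all $\xi\in Y^\sharp$ and all $i,j$ $$\int_Y\tilde a(\xi-\eta)\big(\varphi_i(\eta)-\varphi_i(\xi)\big)d\eta=-\int_{Y^\sharp}a(\xi-\eta)(\eta-\xi)_i\,d\eta ,$$ $$\int_Y\tilde a(\xi-\eta)\big(\varkappa_{ij}(\eta)-\varkappa_{ij}(\xi)\big)d\eta=\Theta_{ij}-\int_{Y^\sharp}a(\xi-\eta)\Big[\tfrac12(\xi-\eta)_i(\xi-\eta)_j-(\xi-\eta)_i\varphi_j(\eta)\Big]d\eta ,$$ $\Theta$ is given by the cell formula $$|Y|\,\Theta_{ij}=\int_{Y^\sharp}\int_{Y}a(\xi-\eta)\Big[\tfrac12(\xi-\eta)_i(\xi-\eta)_j-(\xi-\eta)_i\varphi_j(\eta)\Big]d\eta\,d\xi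 ,$$ and for every Schwartz function $f_0\in\mathcal S(\mathbb R^d)$ the functions $$F^P_\varepsilon(x)=f_0(x)+\varepsilon\sum_i\varphi_i\Big(\frac x\varepsilon\Big)\partial_if_0(x)+\varepsilon^2\sum_{i,j}\varkappa_{ij}\Big(\frac x\varepsilon\Big)\partial_i\partial_jf_0(x)$$ satisfy $$\sup_{x\in\varepsilon Y^\sharp}\Big|\hat L^0_\varepsilon F^P_\varepsilon(x)-\sum_{i,j}\Theta_{ij}\,\partial_i\partial_jf_0(x)\Big|\longrightarrow0\qquad(\varepsilon\to0^+).$$ -/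

import Mathlib

open MeasureTheory Filter Topology
open scoped NNReal ENNReal SchwartzMap

noncomputable section

namespace NonlocalPorosity

/-- The space `ℝ^d` with its Euclidean norm and Lebesgue measure. -/
abbrev E (d : ℕ) : Type := EuclideanSpace ℝ (Fin d)

/-- The point of `ℤ^d ⊆ ℝ^d` with coordinates `n`. -/
def latticePt {d : ℕ} (n : Fin d → ℤ) : E d := WithLp.toLp 2 (fun i => (n i : ℝ))

/-- The half-open unit cell `[0,1)^d`, a fundamental domain of the torus `ℝ^d / ℤ^d`. -/
def unitCell (d : ℕ) : Set (E d) := {x | ∀ i, x i ∈ Set.Ico (0 : ℝ) 1}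

/-- `S` is invariant under integer translations. Such sets are the same thing as subsets of the
torus: `S` is the periodic extension, and `S ∩ [0,1)^d` represents the subset of the torus. Since
the projection to the torus is an open local isometry, openness, closure and regularity of the
boundary may be expressed on either side. -/
def PeriodicSet {d : ℕ} (S : Set (E d)) : Prop :=
  ∀ (n : Fin d → ℤ) (x : E d), x + latticePt n ∈ S ↔ x ∈ S

/-- `ℤ^d`-periodic functions. -/
def PeriodicFun {d : ℕ} (u : E d → ℝ) : Prop :=
  ∀ (n : Fin d → ℤ) (x : E d), u (x + latticePt n) = u x

/-- Lipschitz boundary: near each boundary point, and in suitable Cartesian coordinates (with last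
axis `e`), `Ω` is the region strictly above the graph of a Lipschitz function `γ` of the
coordinates orthogonal to `e`. -/
def HasLipschitzBoundary {d : ℕ} (Ω : Set (E d)) : Prop :=
  ∀ p ∈ frontier Ω, ∃ e : E d, ‖e‖ = 1 ∧ ∃ r : ℝ, 0 < r ∧ ∃ (K : ℝ≥0) (γ : E d → ℝ),
    LipschitzWith K γ ∧
      ∀ x ∈ Metric.ball p r, (x ∈ Ω ↔ γ (x - inner ℝ e x • e) < inner ℝ e x)

/-- The assumptions on the convolution kernel `a`. -/
structure IsKernel {d : ℕ} (a : E d → ℝ) : Prop where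
  nonneg : ∀ z, 0 ≤ a z
  symm : ∀ z, a (-z) = a z
  integrable : Integrable a
  bounded : MemLp a ⊤
  third_moment : Integrable (fun z => ‖z‖ ^ 3 * a z)
  lower_bound : ∃ r₀ : ℝ, 0 < r₀ ∧ ∃ c : ℝ, 0 < c ∧ ∀ z, ‖z‖ ≤ r₀ → c ≤ a z

/-- A jump by `z` is possible: `a > 0` on a set of positive measure in every neighbourhood of `z`.
This is positivity of `a` at `z`, read so that it does not depend on the values of the integrable
function `a` on null sets; where `a` is continuous (or lower semicontinuous) it follows from
`a z > 0`. -/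
def JumpPossible {d : ℕ} (a : E d → ℝ) (z : E d) : Prop :=
  ∀ δ : ℝ, 0 < δ → 0 < ∫ w in Metric.ball z δ, a w

/-- Any two points of `S` are joined by a finite path in `S` whose steps are possible jumps. -/
def JumpConnected {d : ℕ} (a : E d → ℝ) (S : Set (E d)) : Prop :=
  ∀ x ∈ S, ∀ y ∈ S,
    Relation.ReflTransGen (fun p q : E d => p ∈ S ∧ q ∈ S ∧ JumpPossible a (p - q)) x y

/-- The assumptions on the microscopic geometry. Here `G` and `Y` are the periodic extensions to
`ℝ^d` of the two subsets of the torus. -/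
structure IsGeometry {d : ℕ} (a : E d → ℝ) (G Y : Set (E d)) : Prop where
  periodic_G : PeriodicSet G
  periodic_Y : PeriodicSet Y
  isOpen_G : IsOpen G
  isOpen_Y : IsOpen Y
  lipschitz_G : HasLipschitzBoundary G
  lipschitz_Y : HasLipschitzBoundary Y
  nonempty_G : G.Nonempty
  nonempty_Y : Y.Nonempty
  disjoint : Disjoint G Y
  cover : closure G ∪ Y = Set.univ
  unbounded : ¬ Bornology.IsBounded Y
  connected : JumpConnected a Y

/-- `Λ⁰(ξ, η) = 1_Y(ξ) 1_Y(η)`. -/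
def lam0 {d : ℕ} (Y : Set (E d)) (ξ η : E d) : ℝ :=
  Y.indicator (fun _ => (1 : ℝ)) ξ * Y.indicator (fun _ => (1 : ℝ)) η

/-- The operator
`(L⁰_ε u)(x) = ε^{-(d+2)} ∫ a((x-y)/ε) Λ⁰(x/ε, y/ε) (u(y) - u(x)) dy`. -/
def L0 {d : ℕ} (a : E d → ℝ) (Y : Set (E d)) (ε : ℝ) (u : E d → ℝ) (x : E d) : ℝ :=
  (ε ^ (d + 2))⁻¹ *
    ∫ y, a (ε⁻¹ • (x - y)) * lam0 Y (ε⁻¹ • x) (ε⁻¹ • y) * (u y - u x)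

/-- The partial derivative `∂f/∂x_i`. -/
def partialD {d : ℕ} (i : Fin d) (f : E d → ℝ) (x : E d) : ℝ :=
  fderiv ℝ f x (EuclideanSpace.single i 1)

/-- The contraction `M · ∇∇f (x) = ∑_{i,j} M_{ij} ∂_i ∂_j f (x)`. -/
def dotHess {d : ℕ} (M : Matrix (Fin d) (Fin d) ℝ) (f : E d → ℝ) (x : E d) : ℝ :=
  ∑ i, ∑ j, M i j * partialD i (partialD j f) x

/-- `F^P_ε(x) = f₀(x) + ε φ(x/ε)·∇f₀(x) + ε² ϰ(x/ε)·∇∇f₀(x)`. -/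
def FP {d : ℕ} (φ : E d → Fin d → ℝ) (ϰ : E d → Matrix (Fin d) (Fin d) ℝ)
    (f₀ : E d → ℝ) (ε : ℝ) (x : E d) : ℝ :=
  f₀ x + ε * ∑ i, φ (ε⁻¹ • x) i * partialD i f₀ x + ε ^ 2 * dotHess (ϰ (ε⁻¹ • x)) f₀ x

/-- `u` is a bounded continuous periodic function on the periodic set `Y`. Values of `u` off `Y`
play no role. -/
structure IsCorrector {d : ℕ} (Y : Set (E d)) (u : E d → ℝ) : Prop where
  periodic : PeriodicFun u
  continuousOn : ContinuousOn u Y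
  bounded : ∃ C : ℝ, ∀ ξ ∈ Y, |u ξ| ≤ C

/-- The periodization `ã(ξ) = ∑_{n ∈ ℤ^d} a(ξ + n)`. -/
def periodization {d : ℕ} (a : E d → ℝ) (ξ : E d) : ℝ :=
  ∑' n : Fin d → ℤ, a (ξ + latticePt n)

/-- The cell operator `(A^Y u)(ξ) = ∫_Y ã(ξ-η) (u(η) - u(ξ)) dη`, the integral being over one
period of `Y`. -/
def cellOp {d : ℕ} (a : E d → ℝ) (Y : Set (E d)) (u : E d → ℝ) (ξ : E d) : ℝ :=
  ∫ η in Y ∩ unitCell d, periodization a (ξ - η) * (u η - u ξ)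

/-- The integrand `a(ξ-η) [½ (ξ-η)_i (ξ-η)_j - (ξ-η)_i φ_j(η)]`. -/
def effIntegrand {d : ℕ} (a : E d → ℝ) (φ : E d → Fin d → ℝ) (i j : Fin d) (ξ η : E d) : ℝ :=
  a (ξ - η) * (1 / 2 * ((ξ - η) i * (ξ - η) j) - (ξ - η) i * φ η j)

end NonlocalPorosity

end

/-!
The operator is a rescaled jump generator on the periodic set `Y`, and the statement is the
two-scale expansion of `L⁰_ε F^P_ε`, which needs three ingredients.

*Reduction to convolutions.* All objects are expressed by convolutions `conv b v`, with an
integrable kernel `b` on the whole space and a bounded measurable periodic `v`, and by the pairing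
`pair` over one period. Summing over the lattice identifies the cell operator with
`v ↦ a * v - (a * 1_Y) v` (`setIntegral_periodization`, `cellOp_eq`), and translation invariance of integrals of
periodic functions gives the transposition rule `pair_conv`. So even kernels act symmetrically and
odd ones antisymmetrically.

*The cell problem.* On `closure Y` the total jump rate `a * 1_Y` is positive, because `a` is
bounded below near the origin; dividing by it turns the cell problem into an equation
`u - K u = f` for continuous functions on the compact closure of one period. The operator `K` is compact by
Arzelà–Ascoli and `L¹`-continuity of translations. A solution of the homogeneous equation has zero
energy `∫∫ a(ξ-η) (u(ξ)-u(η))²`, hence takes the same value at both ends of each possible jump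
(`eq_of_energyDensity_eq_zero`), so it is constant as `Y` is jump-connected. After a rank one
correction that removes the constants, the Fredholm alternative yields `exists_solution`:
right-hand sides of mean zero over `Y` are attained. For `φ` the mean is zero since `a(z) z` is
odd; for `ϰ` the matrix `Θ` is chosen so that it is. Testing the equation for `φ_i` with `φ_j`
shows that `Θ` is symmetric, and its quadratic form at `v` is half the energy of
`v · ξ + v · φ(ξ)` per volume (`quadraticForm_effMatrix`). If it vanished, this function would be constant on
`Y`; comparing `ξ` with its translates by unit vectors gives `v = 0`.

*The expansion.* In the variables `ξ = x/ε`, `η = y/ε`, Taylor's formula for `f₀`, `∂f₀`, `∂∂f₀`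
shows that the increments of `F^P_ε` equal terms of orders `ε` and `ε²` up to an error
`O(ε³ (|ξ-η| + |ξ-η|² + |ξ-η|³))`. The cell problems say that the former integrate to `0` and to
`ε² Θ · ∇∇f₀`, and the third moment of `a` bounds the contribution of the error, so the difference
is `O(ε)` uniformly (`exists_abs_L0_FP_sub_le`).
-/

noncomputable section

namespace NonlocalPorosity

variable {d : ℕ}

/-! ### The integer lattice and its fundamental domain -/

/-- The inclusion `ℤ^d → ℝ^d` as an additive homomorphism. -/
def latticeHom (d : ℕ) : (Fin d → ℤ) →+ E d where
  toFun := latticePt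
  map_zero' := by ext i; simp [latticePt]
  map_add' m n := by ext i; simp [latticePt]

/-- The lattice `ℤ^d ⊆ ℝ^d` as an additive subgroup. -/
def lattice (d : ℕ) : AddSubgroup (E d) := (latticeHom d).range

lemma latticeHom_injective : Function.Injective (latticeHom d) := by
  intro m n h
  ext i
  have := congrArg (fun x : E d => x i) h
  simpa [latticeHom, latticePt] using this

instance : Countable (lattice d) :=
  (Set.countable_range (latticeHom d)).to_subtype

/-- The lattice is parametrized by integer vectors. -/
def latticeEquiv (d : ℕ) : (Fin d → ℤ) ≃ lattice d :=
  Equiv.ofInjective (latticeHom d) latticeHom_injective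

lemma coe_latticeEquiv (n : Fin d → ℤ) : (latticeEquiv d n : E d) = latticePt n := rfl

lemma latticePt_neg (n : Fin d → ℤ) : latticePt (-n) = -latticePt n :=
  map_neg (latticeHom d) n

lemma measurableSet_unitCell : MeasurableSet (unitCell d) := by
  have : unitCell d = ⋂ i, (fun x : E d => x i) ⁻¹' Set.Ico (0 : ℝ) 1 := by
    ext x; simp [unitCell]
  rw [this]
  exact MeasurableSet.iInter fun i =>
    (by fun_prop : Measurable fun x : E d => x i) measurableSet_Ico

/-- The integer part of a point, taken coordinatewise. -/
def intPart (x : E d) : Fin d → ℤ := fun i => ⌊x i⌋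

/-- The representative of `x` modulo `ℤ^d` in the unit cell. -/
def fracPt (x : E d) : E d := x - latticePt (intPart x)

lemma fracPt_mem (x : E d) : fracPt x ∈ unitCell d := by
  intro i
  simp only [fracPt, intPart, latticePt, PiLp.sub_apply]
  exact ⟨by linarith [Int.floor_le (x i)], by linarith [Int.lt_floor_add_one (x i)]⟩

lemma fracPt_add (n : Fin d → ℤ) (x : E d) : fracPt (x + latticePt n) = fracPt x := by
  ext i
  simp [fracPt, intPart, latticePt]

lemma fracPt_add_latticePt (x : E d) : fracPt x + latticePt (intPart x) = x := by
  simp [fracPt]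

lemma measurable_fracPt : Measurable (fracPt : E d → E d) := by
  unfold fracPt latticePt intPart
  refine measurable_id.sub ?_
  refine (WithLp.measurable_toLp 2 _).comp ?_
  refine measurable_pi_lambda _ fun i => ?_
  have h1 : Measurable fun x : E d => x i := by fun_prop
  exact (measurable_from_top (f := fun k : ℤ => (k : ℝ))).comp h1.floor

lemma PeriodicFun.apply_fracPt {u : E d → ℝ} (hu : PeriodicFun u) (x : E d) :
    u (fracPt x) = u x := by
  conv_rhs => rw [← fracPt_add_latticePt x, hu]

lemma PeriodicSet.fracPt_mem_iff {S : Set (E d)} (hS : PeriodicSet S) (x : E d) :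
    fracPt x ∈ S ↔ x ∈ S := by
  conv_rhs => rw [← fracPt_add_latticePt x, hS]

lemma isAddFundamentalDomain_unitCell :
    IsAddFundamentalDomain (lattice d) (unitCell d) (volume : Measure (E d)) := by
  refine IsAddFundamentalDomain.mk' measurableSet_unitCell.nullMeasurableSet fun x => ?_
  refine ⟨latticeEquiv d (-intPart x), ?_, ?_⟩
  · change latticePt (-intPart x) + x ∈ unitCell d
    rw [latticePt_neg, neg_add_eq_sub]
    exact fracPt_mem x
  · rintro g hg
    obtain ⟨n, rfl⟩ := (latticeEquiv d).surjective g
    congr 1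
    ext i
    have h : (latticePt n + x) i ∈ Set.Ico (0 : ℝ) 1 := hg i
    simp only [latticePt, PiLp.add_apply, Set.mem_Ico] at h
    have : ⌊x i⌋ = -n i := by
      rw [Int.floor_eq_iff]; push_cast; constructor <;> linarith
    simp [intPart, this]

lemma isBounded_unitCell : Bornology.IsBounded (unitCell d) := by
  refine (Metric.isBounded_iff_subset_closedBall 0).2 ⟨Real.sqrt d, fun x hx => ?_⟩
  rw [mem_closedBall_zero_iff, EuclideanSpace.norm_eq]
  refine Real.sqrt_le_sqrt ?_
  calc ∑ i, ‖x i‖ ^ 2 ≤ ∑ _i : Fin d, (1 : ℝ) := Finset.sum_le_sum fun i _ => by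
        rw [Real.norm_eq_abs, sq_abs]
        nlinarith [(hx i).1, (hx i).2]
    _ = d := by simp

lemma volume_unitCell_lt_top : (volume : Measure (E d)) (unitCell d) < ⊤ :=
  isBounded_unitCell.measure_lt_top

instance : IsFiniteMeasure ((volume : Measure (E d)).restrict (unitCell d)) :=
  ⟨by simpa using volume_unitCell_lt_top⟩

/-- The integral of a periodic function over one period does not change under translations. -/
lemma PeriodicFun.setIntegral_unitCell_add {u : E d → ℝ} (hu : PeriodicFun u) (z : E d) :
    ∫ x in unitCell d, u (x + z) = ∫ x in unitCell d, u x := by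
  have h := (isAddFundamentalDomain_unitCell (d := d)).vadd_of_comm z
  have h2 := isAddFundamentalDomain_unitCell.setIntegral_eq h (f := u) (by
    intro g x
    obtain ⟨n, rfl⟩ := (latticeEquiv d).surjective g
    change u (latticePt n + x) = u x
    rw [add_comm, hu])
  rw [h2]
  have h3 := (measurePreserving_vadd z (volume : Measure (E d))).setIntegral_image_emb
    (measurableEmbedding_const_vadd z) u (unitCell d)
  refine Eq.trans ?_ h3.symm
  simp [add_comm]

/-! ### Bounded periodic functions and convolution with integrable kernels -/

/-- Bounded measurable `ℤ^d`-periodic functions on `ℝ^d`. Boundedness holds everywhere, not only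
almost everywhere. -/
structure IsBddPeriodic (v : E d → ℝ) : Prop where
  measurable : Measurable v
  periodic : PeriodicFun v
  bounded : ∃ C, ∀ x, |v x| ≤ C

namespace IsBddPeriodic

variable {v w : E d → ℝ}

lemma add (hv : IsBddPeriodic v) (hw : IsBddPeriodic w) :
    IsBddPeriodic (fun x => v x + w x) where
  measurable := hv.measurable.add hw.measurable
  periodic n x := by simp only [hv.periodic n x, hw.periodic n x]
  bounded := by
    obtain ⟨C, hC⟩ := hv.bounded
    obtain ⟨D, hD⟩ := hw.bounded
    exact ⟨C + D, fun x => (abs_add_le _ _).trans (add_le_add (hC x) (hD x))⟩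

lemma mul (hv : IsBddPeriodic v) (hw : IsBddPeriodic w) :
    IsBddPeriodic (fun x => v x * w x) where
  measurable := hv.measurable.mul hw.measurable
  periodic n x := by simp only [hv.periodic n x, hw.periodic n x]
  bounded := by
    obtain ⟨C, hC⟩ := hv.bounded
    obtain ⟨D, hD⟩ := hw.bounded
    refine ⟨C * D, fun x => ?_⟩
    rw [abs_mul]
    exact mul_le_mul (hC x) (hD x) (abs_nonneg _) ((abs_nonneg _).trans (hC x))

lemma const (c : ℝ) : IsBddPeriodic (fun _ : E d => c) :=
  ⟨measurable_const, fun _ _ => rfl, |c|, fun _ => le_rfl⟩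

lemma const_mul (c : ℝ) (hv : IsBddPeriodic v) : IsBddPeriodic (fun x => c * v x) :=
  (const c).mul hv

lemma sub (hv : IsBddPeriodic v) (hw : IsBddPeriodic w) :
    IsBddPeriodic (fun x => v x - w x) := by
  simpa [sub_eq_add_neg] using hv.add (hw.const_mul (-1))

lemma sum {ι : Type*} (s : Finset ι) {f : ι → E d → ℝ} (hf : ∀ i ∈ s, IsBddPeriodic (f i)) :
    IsBddPeriodic (fun x => ∑ i ∈ s, f i x) := by
  classical
  induction s using Finset.induction_on with
  | empty => simpa using const 0
  | insert i s hi ih =>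
    simp only [Finset.sum_insert hi]
    exact (hf i (by simp)).add (ih fun j hj => hf j (by simp [hj]))

lemma integrableOn (hv : IsBddPeriodic v) : IntegrableOn v (unitCell d) := by
  obtain ⟨C, hC⟩ := hv.bounded
  exact Integrable.of_bound hv.measurable.aestronglyMeasurable C (ae_of_all _ hC)

end IsBddPeriodic

/-- The indicator function of `S`. -/
def ind (S : Set (E d)) : E d → ℝ := S.indicator fun _ => 1

lemma ind_of_mem {S : Set (E d)} {x : E d} (hx : x ∈ S) : ind S x = 1 := by simp [ind, hx]

lemma ind_of_notMem {S : Set (E d)} {x : E d} (hx : x ∉ S) : ind S x = 0 := by simp [ind, hx]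

lemma isBddPeriodic_ind {S : Set (E d)} (hS : PeriodicSet S) (hm : MeasurableSet S) :
    IsBddPeriodic (ind S) where
  measurable := measurable_const.indicator hm
  periodic n x := by
    by_cases hx : x ∈ S
    · rw [ind_of_mem hx, ind_of_mem ((hS n x).2 hx)]
    · rw [ind_of_notMem hx, ind_of_notMem (fun h => hx ((hS n x).1 h))]
  bounded := ⟨1, fun x => by by_cases hx : x ∈ S <;> simp [ind, hx]⟩

/-- The convolution `∫ b(ξ-η) v(η) dη` over the whole space. -/
def conv (b v : E d → ℝ) (ξ : E d) : ℝ := ∫ η, b (ξ - η) * v η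

/-- The pairing `∫ w v` over one period. -/
def pair (w v : E d → ℝ) : ℝ := ∫ x in unitCell d, w x * v x

lemma integrable_conv {b v : E d → ℝ} (hb : Integrable b) (hv : IsBddPeriodic v) (ξ : E d) :
    Integrable fun η => b (ξ - η) * v η := by
  obtain ⟨C, hC⟩ := hv.bounded
  exact (hb.comp_sub_left ξ).mul_bdd (c := C) hv.measurable.aestronglyMeasurable (ae_of_all _ hC)

lemma conv_eq_integral_sub (b v : E d → ℝ) (ξ : E d) :
    conv b v ξ = ∫ z, b z * v (ξ - z) := by
  rw [conv, ← integral_sub_left_eq_self _ volume ξ]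
  simp

/-- Translations act continuously on `L¹`. -/
lemma tendsto_integral_abs_translate_sub {b : E d → ℝ} (hb : Integrable b) :
    Tendsto (fun h : E d => ∫ z, |b (h + z) - b z|) (𝓝 0) (𝓝 0) := by
  have : Fact ((1 : ℝ≥0∞) ≠ ⊤) := ⟨ENNReal.one_ne_top⟩
  have hm : MemLp b 1 := memLp_one_iff_integrable.2 hb
  have hc : Continuous fun h : E d => DomAddAct.mk h +ᵥ hm.toLp b :=
    (DomAddAct.continuous_mk).vadd continuous_const
  have ht : Tendsto (fun h : E d => dist (DomAddAct.mk h +ᵥ hm.toLp b) (hm.toLp b))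
      (𝓝 0) (𝓝 0) := by
    have := (hc.dist (continuous_const (y := hm.toLp b))).tendsto 0
    simpa using this
  refine ht.congr fun h => ?_
  rw [dist_eq_norm, DomAddAct.mk_vadd_toLp, ← MemLp.toLp_sub, L1.norm_eq_integral_norm]
  refine integral_congr_ae ?_
  filter_upwards [MemLp.coeFn_toLp
    ((hm.comp_measurePreserving (measurePreserving_vadd h volume)).sub hm)] with z hz
  exact congrArg norm hz

/-- The modulus of continuity of `b * v` is controlled by the `L¹` modulus of continuity of `b`
and the supremum of `v`. -/
lemma abs_conv_sub_conv_le {b v : E d → ℝ} (hb : Integrable b) (hv : IsBddPeriodic v) {C : ℝ}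
    (hC : ∀ x, |v x| ≤ C) (ξ ξ' : E d) :
    |conv b v ξ - conv b v ξ'| ≤ C * ∫ z, |b ((ξ - ξ') + z) - b z| := by
  rw [conv, conv, ← integral_sub (integrable_conv hb hv ξ) (integrable_conv hb hv ξ')]
  have h1 : ∫ z, |b ((ξ - ξ') + z) - b z| = ∫ η, |b (ξ - η) - b (ξ' - η)| := by
    rw [← integral_sub_left_eq_self _ volume ξ']
    refine integral_congr_ae (ae_of_all _ fun η => ?_)
    simp only
    congr 3; abel
  rw [h1, ← integral_const_mul]
  rw [← Real.norm_eq_abs]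
  refine norm_integral_le_of_norm_le ?_ (ae_of_all _ fun η => ?_)
  · exact (((hb.comp_sub_left ξ).sub (hb.comp_sub_left ξ')).abs).const_mul C
  · rw [← sub_mul, Real.norm_eq_abs, abs_mul, mul_comm]
    exact mul_le_mul_of_nonneg_right (hC η) (abs_nonneg _)

lemma abs_conv_le {b v : E d → ℝ} (hb : Integrable b) {C : ℝ} (hC : ∀ x, |v x| ≤ C) (ξ : E d) :
    |conv b v ξ| ≤ C * ∫ z, |b z| := by
  rw [conv_eq_integral_sub, ← integral_const_mul, ← Real.norm_eq_abs]
  refine norm_integral_le_of_norm_le (hb.abs.const_mul C) (ae_of_all _ fun z => ?_)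
  rw [Real.norm_eq_abs, abs_mul, mul_comm]
  exact mul_le_mul_of_nonneg_right (hC _) (abs_nonneg _)

lemma continuous_conv {b v : E d → ℝ} (hb : Integrable b) (hv : IsBddPeriodic v) :
    Continuous (conv b v) := by
  obtain ⟨C, hC⟩ := hv.bounded
  rw [continuous_iff_continuousAt]
  intro ξ'
  rw [ContinuousAt, tendsto_iff_dist_tendsto_zero]
  have h1 : Tendsto (fun ξ : E d => ξ - ξ') (𝓝 ξ') (𝓝 0) := by
    have : Continuous fun ξ : E d => ξ - ξ' := by fun_prop
    simpa using this.tendsto ξ'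
  have h2 := ((tendsto_integral_abs_translate_sub hb).comp h1).const_mul C
  rw [mul_zero] at h2
  exact squeeze_zero (fun _ => dist_nonneg)
    (fun ξ => abs_conv_sub_conv_le hb hv hC ξ ξ') h2

lemma isBddPeriodic_conv {b v : E d → ℝ} (hb : Integrable b) (hv : IsBddPeriodic v) :
    IsBddPeriodic (conv b v) where
  measurable := (continuous_conv hb hv).measurable
  periodic n x := by
    simp only [conv_eq_integral_sub]
    congr 1; ext z
    rw [← hv.periodic n (x - z)]
    congr 2; abel
  bounded := by
    obtain ⟨C, hC⟩ := hv.bounded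
    exact ⟨_, abs_conv_le hb hC⟩

lemma integrable_mul_kernel_mul {b v w : E d → ℝ} (hb : Integrable b) (hv : IsBddPeriodic v)
    (hw : IsBddPeriodic w) {g : E d × E d → E d} (hg : Measurable g) :
    Integrable (fun p : E d × E d => w p.1 * (b p.2 * v (g p)))
      ((volume.restrict (unitCell d)).prod volume) := by
  obtain ⟨C, hC⟩ := hv.bounded
  obtain ⟨D, hD⟩ := hw.bounded
  have h0 : Integrable (fun p : E d × E d => b p.2) ((volume.restrict (unitCell d)).prod volume) :=
    hb.comp_snd _
  have h1 := h0.mul_bdd (c := C) (hv.measurable.comp hg).aestronglyMeasurable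
    (ae_of_all _ fun p => hC _)
  exact h1.bdd_mul (c := D) (hw.measurable.comp measurable_fst).aestronglyMeasurable
    (ae_of_all _ fun p => hD _)

/-- The transpose of `v ↦ b * v` for the pairing over one period is convolution with the
reflected kernel. -/
lemma pair_conv {b v w : E d → ℝ} (hb : Integrable b) (hv : IsBddPeriodic v)
    (hw : IsBddPeriodic w) :
    pair w (conv b v) = pair v (conv (fun z => b (-z)) w) := by
  have e1 : pair w (conv b v) = ∫ z, b z * ∫ x in unitCell d, w x * v (x - z) := by
    calc pair w (conv b v) = ∫ x in unitCell d, ∫ z, w x * (b z * v (x - z)) := by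
          simp only [pair, conv_eq_integral_sub, integral_const_mul]
      _ = ∫ z, ∫ x in unitCell d, w x * (b z * v (x - z)) :=
          integral_integral_swap (integrable_mul_kernel_mul hb hv hw
            (g := fun p => p.1 - p.2) (by fun_prop))
      _ = _ := by
          congr 1; ext z
          rw [← integral_const_mul]
          congr 1; ext x; ring
  have e2 : pair v (conv (fun z => b (-z)) w) =
      ∫ z, b z * ∫ x in unitCell d, v x * w (x + z) := by
    calc pair v (conv (fun z => b (-z)) w)
        = ∫ x in unitCell d, ∫ z, v x * (b z * w (x + z)) := by
          simp only [pair, conv_eq_integral_sub, integral_const_mul]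
          congr 1; ext x
          rw [← integral_neg_eq_self]
          simp
      _ = ∫ z, ∫ x in unitCell d, v x * (b z * w (x + z)) :=
          integral_integral_swap (integrable_mul_kernel_mul hb hw hv
            (g := fun p => p.1 + p.2) (by fun_prop))
      _ = _ := by
          congr 1; ext z
          rw [← integral_const_mul]
          congr 1; ext x; ring
  rw [e1, e2]
  congr 1; ext z
  congr 1
  have hp : PeriodicFun fun x => w x * v (x - z) := by
    intro n x
    simp only
    rw [hw.periodic, ← hv.periodic n (x - z)]
    congr 2; abel
  rw [← hp.setIntegral_unitCell_add z]
  congr 1; ext x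
  rw [add_sub_cancel_right, mul_comm]

lemma integrable_cell_prod {b v w : E d → ℝ} (hb : Integrable b) (hv : IsBddPeriodic v)
    (hw : IsBddPeriodic w) :
    Integrable (fun p : E d × E d => w p.1 * (b (p.1 - p.2) * v p.2))
      (volume.prod (volume.restrict (unitCell d))) := by
  obtain ⟨C, hC⟩ := hv.bounded
  obtain ⟨D, hD⟩ := hw.bounded
  have h0 : Integrable (fun p : E d × E d => (1 : ℝ) * b (p.1 - p.2))
      (volume.prod (volume.restrict (unitCell d))) := by
    have := Integrable.convolution_integrand (ContinuousLinearMap.mul ℝ ℝ)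
      (integrable_const (1 : ℝ) (μ := (volume : Measure (E d)).restrict (unitCell d))) hb
    simpa using this
  simp only [one_mul] at h0
  have h1 := h0.mul_bdd (c := C) (hv.measurable.comp measurable_snd).aestronglyMeasurable
    (ae_of_all _ fun p => hC _)
  exact h1.bdd_mul (c := D) (hw.measurable.comp measurable_fst).aestronglyMeasurable
    (ae_of_all _ fun p => hD _)

/-- Integrating a diagonally periodic kernel with the second variable in one period and the first
one in the whole space gives the same as the other way round. -/
lemma integral_mul_setIntegral_cell {b v w : E d → ℝ} (hb : Integrable b) (hv : IsBddPeriodic v)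
    (hw : IsBddPeriodic w) :
    ∫ ξ, w ξ * ∫ η in unitCell d, b (ξ - η) * v η = pair w (conv b v) := by
  rw [pair_conv hb hv hw]
  calc ∫ ξ, w ξ * ∫ η in unitCell d, b (ξ - η) * v η
      = ∫ ξ, ∫ η in unitCell d, w ξ * (b (ξ - η) * v η) := by simp only [integral_const_mul]
    _ = ∫ η in unitCell d, ∫ ξ, w ξ * (b (ξ - η) * v η) :=
        integral_integral_swap (integrable_cell_prod hb hv hw)
    _ = _ := by
        simp only [pair, conv, neg_sub, ← integral_const_mul]
        congr 1; ext η
        congr 1; ext ξ; ring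

/-- Convolution with the periodized kernel over one period is convolution with the kernel itself
over the whole space. -/
lemma setIntegral_periodization {b v : E d → ℝ} (hb : Integrable b) (hv : IsBddPeriodic v)
    (ξ : E d) :
    ∫ η in unitCell d, periodization b (ξ - η) * v η = conv b v ξ := by
  have hF := integrable_conv hb hv ξ
  have hshift : ∀ (g : lattice d) (η : E d),
      b (ξ - (g +ᵥ η)) * v (g +ᵥ η) = b (ξ - η - g) * v η := by
    intro g η
    obtain ⟨n, rfl⟩ := (latticeEquiv d).surjective g
    change b (ξ - (latticePt n + η)) * v (latticePt n + η) = b (ξ - η - latticePt n) * v η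
    rw [add_comm, hv.periodic]
    congr 2; abel
  rw [conv, isAddFundamentalDomain_unitCell.integral_eq_tsum'' _ hF, ← integral_tsum]
  · refine integral_congr_ae (ae_of_all _ fun η => ?_)
    simp only [hshift]
    rw [tsum_mul_right, periodization]
    congr 1
    rw [← (latticeEquiv d).tsum_eq, ← (Equiv.neg (Fin d → ℤ)).tsum_eq]
    refine tsum_congr fun n => ?_
    rw [coe_latticeEquiv, Equiv.neg_apply, latticePt_neg, ← sub_eq_add_neg]
  · intro g
    exact ((measurePreserving_vadd g (volume : Measure (E d))).integrable_comp_of_integrable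
      hF).aestronglyMeasurable.restrict
  · have h := isAddFundamentalDomain_unitCell.lintegral_eq_tsum''
      (fun η : E d => ‖b (ξ - η) * v η‖ₑ)
    rw [← h]
    exact hF.2.ne

/-! ### Linearity and symmetry of the pairing and the convolution -/

lemma pair_comm (w v : E d → ℝ) : pair w v = pair v w := by
  simp only [pair, mul_comm]

lemma pair_add {u v w : E d → ℝ} (hw : IsBddPeriodic w) (hv : IsBddPeriodic v)
    (hu : IsBddPeriodic u) : pair w (fun x => v x + u x) = pair w v + pair w u := by
  simp only [pair, mul_add]
  exact integral_add (hw.mul hv).integrableOn (hw.mul hu).integrableOn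

lemma pair_sub {u v w : E d → ℝ} (hw : IsBddPeriodic w) (hv : IsBddPeriodic v)
    (hu : IsBddPeriodic u) : pair w (fun x => v x - u x) = pair w v - pair w u := by
  simp only [pair, mul_sub]
  exact integral_sub (hw.mul hv).integrableOn (hw.mul hu).integrableOn

lemma pair_const_mul (c : ℝ) (w v : E d → ℝ) : pair w (fun x => c * v x) = c * pair w v := by
  simp only [pair, ← integral_const_mul]
  congr 1; ext x; ring

lemma pair_sum {ι : Type*} (s : Finset ι) {w : E d → ℝ} {f : ι → E d → ℝ} (hw : IsBddPeriodic w)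
    (hf : ∀ i ∈ s, IsBddPeriodic (f i)) :
    pair w (fun x => ∑ i ∈ s, f i x) = ∑ i ∈ s, pair w (f i) := by
  simp only [pair, Finset.mul_sum]
  exact integral_finsetSum _ fun i hi => (hw.mul (hf i hi)).integrableOn

lemma pair_congr {w v w' v' : E d → ℝ} (h : ∀ x, w x * v x = w' x * v' x) :
    pair w v = pair w' v' := by
  simp only [pair, h]

lemma conv_add {b u v : E d → ℝ} (hb : Integrable b) (hu : IsBddPeriodic u)
    (hv : IsBddPeriodic v) (ξ : E d) :
    conv b (fun x => u x + v x) ξ = conv b u ξ + conv b v ξ := by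
  simp only [conv, mul_add]
  exact integral_add (integrable_conv hb hu ξ) (integrable_conv hb hv ξ)

lemma conv_sub {b u v : E d → ℝ} (hb : Integrable b) (hu : IsBddPeriodic u)
    (hv : IsBddPeriodic v) (ξ : E d) :
    conv b (fun x => u x - v x) ξ = conv b u ξ - conv b v ξ := by
  simp only [conv, mul_sub]
  exact integral_sub (integrable_conv hb hu ξ) (integrable_conv hb hv ξ)

lemma conv_const_mul (b v : E d → ℝ) (c : ℝ) (ξ : E d) :
    conv b (fun x => c * v x) ξ = c * conv b v ξ := by
  simp only [conv, ← integral_const_mul]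
  congr 1; ext x; ring

lemma conv_sum {ι : Type*} (s : Finset ι) {b : E d → ℝ} {f : ι → E d → ℝ} (hb : Integrable b)
    (hf : ∀ i ∈ s, IsBddPeriodic (f i)) (ξ : E d) :
    conv b (fun x => ∑ i ∈ s, f i x) ξ = ∑ i ∈ s, conv b (f i) ξ := by
  simp only [conv, Finset.mul_sum]
  exact integral_finsetSum _ fun i hi => integrable_conv hb (hf i hi) ξ

/-- Evenness of the kernel makes `v ↦ b * v` symmetric for the pairing. -/
lemma pair_conv_of_even {b v w : E d → ℝ} (hb : Integrable b) (hs : ∀ z, b (-z) = b z)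
    (hv : IsBddPeriodic v) (hw : IsBddPeriodic w) :
    pair w (conv b v) = pair v (conv b w) := by
  rw [pair_conv hb hv hw]
  simp only [hs]

lemma pair_conv_of_odd {b v w : E d → ℝ} (hb : Integrable b) (hs : ∀ z, b (-z) = -b z)
    (hv : IsBddPeriodic v) (hw : IsBddPeriodic w) :
    pair w (conv b v) = -pair v (conv b w) := by
  rw [pair_conv hb hv hw]
  simp only [hs, pair, conv, neg_mul, integral_neg, mul_neg]

/-! ### Moments of the kernel -/

lemma IsKernel.integrable_pow {a : E d → ℝ} (ha : IsKernel a) {k : ℕ} (hk : k ≤ 3) :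
    Integrable fun z => ‖z‖ ^ k * a z := by
  refine (ha.integrable.add ha.third_moment).mono'
    ((by fun_prop : Continuous fun z : E d => ‖z‖ ^ k).aestronglyMeasurable.mul
      ha.integrable.aestronglyMeasurable) (ae_of_all _ fun z => ?_)
  have h0 := ha.nonneg z
  rw [Real.norm_eq_abs, abs_of_nonneg (by positivity)]
  change ‖z‖ ^ k * a z ≤ a z + ‖z‖ ^ 3 * a z
  have : ‖z‖ ^ k ≤ 1 + ‖z‖ ^ 3 := by
    rcases le_total ‖z‖ 1 with h | h
    · have := pow_le_one₀ (n := k) (norm_nonneg z) h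
      have := pow_nonneg (norm_nonneg z) 3
      linarith
    · have := pow_le_pow_right₀ h hk
      linarith
  nlinarith

lemma IsKernel.integrable_mul_linear {a : E d → ℝ} (ha : IsKernel a) (ℓ : E d →L[ℝ] ℝ) :
    Integrable fun z => a z * ℓ z := by
  refine ((ha.integrable_pow (k := 1) (by norm_num)).const_mul ‖ℓ‖).mono'
    (ha.integrable.aestronglyMeasurable.mul ℓ.continuous.aestronglyMeasurable)
    (ae_of_all _ fun z => ?_)
  rw [norm_mul, Real.norm_eq_abs, abs_of_nonneg (ha.nonneg z)]
  have := mul_le_mul_of_nonneg_left (ℓ.le_opNorm z) (ha.nonneg z)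
  calc _ ≤ _ := this
    _ = _ := by ring

lemma IsKernel.integrable_mul_linear_mul {a : E d → ℝ} (ha : IsKernel a) (ℓ ℓ' : E d →L[ℝ] ℝ) :
    Integrable fun z => a z * (ℓ z * ℓ' z) := by
  refine ((ha.integrable_pow (k := 2) (by norm_num)).const_mul (‖ℓ‖ * ‖ℓ'‖)).mono'
    (ha.integrable.aestronglyMeasurable.mul
      (ℓ.continuous.mul ℓ'.continuous).aestronglyMeasurable)
    (ae_of_all _ fun z => ?_)
  rw [norm_mul, norm_mul, Real.norm_eq_abs, abs_of_nonneg (ha.nonneg z)]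
  have := mul_le_mul_of_nonneg_left (mul_le_mul (ℓ.le_opNorm z) (ℓ'.le_opNorm z)
    (norm_nonneg _) (by positivity)) (ha.nonneg z)
  calc _ ≤ _ := this
    _ = _ := by ring

/-! ### The energy identity and the constancy of functions of zero energy -/

/-- The energy density `∫_Y a(ξ-η) (ℓ(ξ-η) + φ(ξ) - φ(η))² dη` of the function `ℓ + φ`. -/
def energyDensity (a : E d → ℝ) (Y : Set (E d)) (ℓ : E d →L[ℝ] ℝ) (φ : E d → ℝ) (ξ : E d) : ℝ :=
  ∫ η, a (ξ - η) * ind Y η * (ℓ (ξ - η) + φ ξ - φ η) ^ 2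

section Energy

variable {a : E d → ℝ} {Y : Set (E d)} {φ : E d → ℝ}

lemma energyDensity_integrand (hφ : ∀ x, ind Y x * φ x = φ x) (ℓ : E d →L[ℝ] ℝ) (ξ η : E d) :
    a (ξ - η) * ind Y η * (ℓ (ξ - η) + φ ξ - φ η) ^ 2 =
      (a (ξ - η) * (ℓ (ξ - η) * ℓ (ξ - η))) * ind Y η
      + (2 * φ ξ) * ((a (ξ - η) * ℓ (ξ - η)) * ind Y η)
      - 2 * ((a (ξ - η) * ℓ (ξ - η)) * φ η)
      + φ ξ ^ 2 * (a (ξ - η) * ind Y η)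
      - (2 * φ ξ) * (a (ξ - η) * φ η)
      + a (ξ - η) * (φ η * φ η) := by
  linear_combination (-2 * a (ξ - η) * ℓ (ξ - η) - 2 * φ ξ * a (ξ - η) + a (ξ - η) * φ η) * hφ η

lemma integrable_energyDensity (ha : IsKernel a) (hY : IsBddPeriodic (ind Y))
    (hφ : IsBddPeriodic φ) (hφY : ∀ x, ind Y x * φ x = φ x) (ℓ : E d →L[ℝ] ℝ) (ξ : E d) :
    Integrable fun η => a (ξ - η) * ind Y η * (ℓ (ξ - η) + φ ξ - φ η) ^ 2 := by
  simp only [energyDensity_integrand hφY]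
  have h1 := ha.integrable_mul_linear ℓ
  have h2 := ha.integrable_mul_linear_mul ℓ ℓ
  exact (((((integrable_conv h2 hY ξ).add ((integrable_conv h1 hY ξ).const_mul _)).sub
    ((integrable_conv h1 hφ ξ).const_mul _)).add
    ((integrable_conv ha.integrable hY ξ).const_mul _)).sub
    ((integrable_conv ha.integrable hφ ξ).const_mul _)).add
    (integrable_conv ha.integrable (hφ.mul hφ) ξ)

lemma energyDensity_eq (ha : IsKernel a) (hY : IsBddPeriodic (ind Y))
    (hφ : IsBddPeriodic φ) (hφY : ∀ x, ind Y x * φ x = φ x) (ℓ : E d →L[ℝ] ℝ) (ξ : E d) :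
    energyDensity a Y ℓ φ ξ =
      conv (fun z => a z * (ℓ z * ℓ z)) (ind Y) ξ
      + 2 * φ ξ * conv (fun z => a z * ℓ z) (ind Y) ξ
      - 2 * conv (fun z => a z * ℓ z) φ ξ
      + φ ξ ^ 2 * conv a (ind Y) ξ - 2 * φ ξ * conv a φ ξ
      + conv a (fun x => φ x * φ x) ξ := by
  simp only [energyDensity, energyDensity_integrand hφY]
  have h1 := ha.integrable_mul_linear ℓ
  have h2 := ha.integrable_mul_linear_mul ℓ ℓ
  have i1 := integrable_conv h2 hY ξ
  have i2 := (integrable_conv h1 hY ξ).const_mul (2 * φ ξ)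
  have i3 := (integrable_conv h1 hφ ξ).const_mul 2
  have i4 := (integrable_conv ha.integrable hY ξ).const_mul (φ ξ ^ 2)
  have i5 := (integrable_conv ha.integrable hφ ξ).const_mul (2 * φ ξ)
  have i6 := integrable_conv ha.integrable (hφ.mul hφ) ξ
  have key := integral_add' ((((i1.add i2).sub i3).add i4).sub i5) i6
  rw [integral_sub' (((i1.add i2).sub i3).add i4) i5, integral_add' ((i1.add i2).sub i3) i4,
    integral_sub' (i1.add i2) i3, integral_add' i1 i2] at key
  simp only [integral_const_mul] at key
  exact key

lemma isBddPeriodic_energyDensity (ha : IsKernel a) (hY : IsBddPeriodic (ind Y))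
    (hφ : IsBddPeriodic φ) (hφY : ∀ x, ind Y x * φ x = φ x) (ℓ : E d →L[ℝ] ℝ) :
    IsBddPeriodic (energyDensity a Y ℓ φ) := by
  have e := funext (energyDensity_eq ha hY hφ hφY ℓ)
  have h1 := ha.integrable_mul_linear ℓ
  have h2 := ha.integrable_mul_linear_mul ℓ ℓ
  rw [e]
  simp only [sq]
  exact (((((isBddPeriodic_conv h2 hY).add ((hφ.const_mul 2).mul (isBddPeriodic_conv h1 hY))).sub
    ((isBddPeriodic_conv h1 hφ).const_mul 2)).add
    ((hφ.mul hφ).mul (isBddPeriodic_conv ha.integrable hY))).sub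
    ((hφ.const_mul 2).mul (isBddPeriodic_conv ha.integrable hφ))).add
    (isBddPeriodic_conv ha.integrable (hφ.mul hφ))

lemma continuousOn_energyDensity (ha : IsKernel a) (hY : IsBddPeriodic (ind Y))
    (hφ : IsBddPeriodic φ) (hφY : ∀ x, ind Y x * φ x = φ x) (hc : ContinuousOn φ Y)
    (ℓ : E d →L[ℝ] ℝ) : ContinuousOn (energyDensity a Y ℓ φ) Y := by
  have e := funext (energyDensity_eq ha hY hφ hφY ℓ)
  have h1 := ha.integrable_mul_linear ℓ
  have h2 := ha.integrable_mul_linear_mul ℓ ℓ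
  rw [e]
  have c1 := (continuous_conv h2 hY).continuousOn (s := Y)
  have c2 := (continuous_conv h1 hY).continuousOn (s := Y)
  have c3 := (continuous_conv h1 hφ).continuousOn (s := Y)
  have c4 := (continuous_conv ha.integrable hY).continuousOn (s := Y)
  have c5 := (continuous_conv ha.integrable hφ).continuousOn (s := Y)
  have c6 := (continuous_conv ha.integrable (hφ.mul hφ)).continuousOn (s := Y)
  fun_prop

/-- The total energy of `ℓ + φ` over one period, expanded by the symmetries of the kernel. -/
lemma pair_energyDensity (ha : IsKernel a) (hY : IsBddPeriodic (ind Y))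
    (hφ : IsBddPeriodic φ) (hφY : ∀ x, ind Y x * φ x = φ x) (ℓ : E d →L[ℝ] ℝ) :
    pair (ind Y) (energyDensity a Y ℓ φ) =
      pair (ind Y) (conv (fun z => a z * (ℓ z * ℓ z)) (ind Y))
      + 4 * pair φ (conv (fun z => a z * ℓ z) (ind Y))
      + 2 * (pair φ (fun ξ => conv a (ind Y) ξ * φ ξ) - pair φ (conv a φ)) := by
  have e := funext (energyDensity_eq ha hY hφ hφY ℓ)
  have h1 := ha.integrable_mul_linear ℓ
  have h2 := ha.integrable_mul_linear_mul ℓ ℓ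
  have p1 := isBddPeriodic_conv h2 hY
  have p2 := (hφ.const_mul 2).mul (isBddPeriodic_conv h1 hY)
  have p3 := (isBddPeriodic_conv h1 hφ).const_mul 2
  have p4 := (hφ.mul hφ).mul (isBddPeriodic_conv ha.integrable hY)
  have p5 := (hφ.const_mul 2).mul (isBddPeriodic_conv ha.integrable hφ)
  have p6 := isBddPeriodic_conv ha.integrable (hφ.mul hφ)
  rw [e]
  simp only [sq]
  rw [pair_add hY ((((p1.add p2).sub p3).add p4).sub p5) p6,
    pair_sub hY (((p1.add p2).sub p3).add p4) p5, pair_add hY ((p1.add p2).sub p3) p4,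
    pair_sub hY (p1.add p2) p3, pair_add hY p1 p2, pair_const_mul]
  have e2 : pair (ind Y) (fun x => 2 * φ x * conv (fun z => a z * ℓ z) (ind Y) x) =
      2 * pair φ (conv (fun z => a z * ℓ z) (ind Y)) := by
    rw [← pair_const_mul]
    exact pair_congr fun x => by
      linear_combination (2 * conv (fun z => a z * ℓ z) (ind Y) x) * hφY x
  have e3 : pair (ind Y) (conv (fun z => a z * ℓ z) φ) =
      -pair φ (conv (fun z => a z * ℓ z) (ind Y)) :=
    pair_conv_of_odd h1 (fun z => by rw [ha.symm, map_neg, mul_neg]) hφ hY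
  have e4 : pair (ind Y) (fun x => φ x * φ x * conv a (ind Y) x) =
      pair φ (fun ξ => conv a (ind Y) ξ * φ ξ) :=
    pair_congr fun x => by linear_combination (φ x * conv a (ind Y) x) * hφY x
  have e5 : pair (ind Y) (fun x => 2 * φ x * conv a φ x) = 2 * pair φ (conv a φ) := by
    rw [← pair_const_mul]
    exact pair_congr fun x => by linear_combination (2 * conv a φ x) * hφY x
  have e6 : pair (ind Y) (conv a fun x => φ x * φ x) =
      pair φ (fun ξ => conv a (ind Y) ξ * φ ξ) := by
    rw [pair_conv_of_even ha.integrable ha.symm (hφ.mul hφ) hY]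
    exact pair_congr fun x => by ring
  rw [e2, e3, e4, e5, e6]
  ring

lemma energyDensity_nonneg (ha : IsKernel a) (ℓ : E d →L[ℝ] ℝ) (ξ : E d) :
    0 ≤ energyDensity a Y ℓ φ ξ := by
  refine integral_nonneg fun η => ?_
  have h1 := ha.nonneg (ξ - η)
  have h2 : 0 ≤ ind Y η := Set.indicator_nonneg (fun _ _ => zero_le_one) _
  positivity

lemma pair_energyDensity_nonneg (ha : IsKernel a) (ℓ : E d →L[ℝ] ℝ) :
    0 ≤ pair (ind Y) (energyDensity a Y ℓ φ) := by
  refine integral_nonneg fun ξ => ?_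
  exact mul_nonneg (Set.indicator_nonneg (fun _ _ => zero_le_one) _) (energyDensity_nonneg ha ℓ ξ)

/-- A nonnegative bounded periodic function that is continuous on the periodic open set `Y` and has
zero integral over one period of `Y` vanishes on `Y`. -/
lemma eq_zero_of_pair_ind_eq_zero (hYo : IsOpen Y) (hY : IsBddPeriodic (ind Y)) {h : E d → ℝ}
    (hh : IsBddPeriodic h) (h0 : ∀ x, 0 ≤ h x) (hc : ContinuousOn h Y)
    (hp : pair (ind Y) h = 0) : ∀ x ∈ Y, h x = 0 := by
  have hn : ∀ x, 0 ≤ ind Y x * h x := fun x =>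
    mul_nonneg (Set.indicator_nonneg (fun _ _ => zero_le_one) _) (h0 x)
  have hq := hY.mul hh
  have hae := (integral_eq_zero_iff_of_nonneg hn hq.integrableOn).1 hp
  have hnull : volume {x | ind Y x * h x ≠ 0} = 0 := by
    refine isAddFundamentalDomain_unitCell.measure_zero_of_invariant _ (fun g => ?_) ?_
    · obtain ⟨n, rfl⟩ := (latticeEquiv d).surjective g
      ext x
      rw [Set.mem_vadd_set_iff_neg_vadd_mem]
      change ind Y (-latticePt n + x) * h (-latticePt n + x) ≠ 0 ↔ ind Y x * h x ≠ 0
      rw [← latticePt_neg, add_comm, hY.periodic, hh.periodic]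
    · rw [Filter.EventuallyEq, ae_restrict_iff' measurableSet_unitCell] at hae
      refine measure_mono_null ?_ (ae_iff.1 hae)
      rintro x ⟨hx, hx'⟩
      exact fun hcon => hx (hcon hx')
  have hY0 : h =ᵐ[volume.restrict Y] fun _ => 0 := by
    rw [Filter.EventuallyEq, ae_restrict_iff' hYo.measurableSet]
    filter_upwards [ae_iff.2 hnull] with x hx hxY
    simpa [ind_of_mem hxY] using hx
  exact Measure.eqOn_open_of_ae_eq hY0 hYo hc continuousOn_const

/-- If the energy density of `ℓ + φ` vanishes on the jump-connected set `Y`, then `ℓ + φ` is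
constant on `Y`: it takes the same value at the endpoints of each possible jump. -/
lemma eq_of_energyDensity_eq_zero (ha : IsKernel a) (hYo : IsOpen Y) (hY : IsBddPeriodic (ind Y))
    (hconn : JumpConnected a Y) (hφ : IsBddPeriodic φ) (hφY : ∀ x, ind Y x * φ x = φ x)
    (hc : ContinuousOn φ Y) (ℓ : E d →L[ℝ] ℝ) (h0 : ∀ x ∈ Y, energyDensity a Y ℓ φ x = 0) :
    ∀ x ∈ Y, ∀ y ∈ Y, ℓ x + φ x = ℓ y + φ y := by
  intro x hx y hy
  have step : ∀ p q : E d, p ∈ Y ∧ q ∈ Y ∧ JumpPossible a (p - q) → ℓ p + φ p = ℓ q + φ q := by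
    rintro p q ⟨hp, hq, hj⟩
    by_contra hne
    have hcU : ContinuousAt (fun z => ℓ z + φ z) q :=
      ℓ.continuous.continuousAt.add (hc.continuousAt (hYo.mem_nhds hq))
    have hev : ∀ᶠ z in 𝓝 q, ℓ z + φ z ≠ ℓ p + φ p ∧ z ∈ Y :=
      (hcU.eventually_ne (Ne.symm hne)).and (hYo.mem_nhds hq)
    obtain ⟨δ, hδ, hball⟩ := Metric.eventually_nhds_iff_ball.1 hev
    have hae := (integral_eq_zero_iff_of_nonneg (fun η => by
      have h1 := ha.nonneg (p - η)
      have h2 : 0 ≤ ind Y η := Set.indicator_nonneg (fun _ _ => zero_le_one) _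
      positivity) (integrable_energyDensity ha hY hφ hφY ℓ p)).1 (h0 p hp)
    have hae' := (quasiMeasurePreserving_sub_left volume p).ae hae
    -- If the values at `p` and near `q` differed, `a` would vanish almost everywhere near `p - q`.
    refine (hj δ hδ).ne' (setIntegral_eq_zero_of_ae_eq_zero ?_)
    filter_upwards [hae'] with w hw hwb
    have hwb' : p - w ∈ Metric.ball q δ := by
      rw [Metric.mem_ball, dist_eq_norm] at hwb ⊢
      rwa [show p - w - q = -(w - (p - q)) by abel, norm_neg]
    obtain ⟨hne', hwY⟩ := hball _ hwb'
    simp only [sub_sub_cancel, ind_of_mem hwY, mul_one, Pi.zero_apply] at hw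
    rcases mul_eq_zero.1 hw with h | h
    · exact h
    · exfalso
      apply hne'
      have h' := pow_eq_zero_iff (two_ne_zero) |>.1 h
      rw [map_sub]
      linarith
  have hpath := hconn x hx y hy
  induction hpath with
  | refl => rfl
  | tail _ hstep ih =>
    exact (ih hstep.1).trans (step _ _ hstep)

end Energy

/-! ### Solvability of the cell problem -/

variable {a : E d → ℝ} {Y : Set (E d)}

lemma volume_inter_unitCell_pos (hYp : PeriodicSet Y) (hYo : IsOpen Y) (hYn : Y.Nonempty) :
    0 < volume (Y ∩ unitCell d) := by
  rw [pos_iff_ne_zero]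
  intro h
  refine (hYo.measure_pos volume hYn).ne'
    (isAddFundamentalDomain_unitCell.measure_zero_of_invariant Y (fun g => ?_) h)
  obtain ⟨n, rfl⟩ := (latticeEquiv d).surjective g
  ext x
  rw [Set.mem_vadd_set_iff_neg_vadd_mem]
  change -latticePt n + x ∈ Y ↔ x ∈ Y
  rw [← latticePt_neg, add_comm, hYp]

lemma ind_nonneg (S : Set (E d)) (x : E d) : 0 ≤ ind S x :=
  Set.indicator_nonneg (fun _ _ => zero_le_one) _

/-- The total jump rate `∫_Y a(ξ-η) dη` is positive up to the boundary of `Y`, since the kernel is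
bounded below near the origin. -/
lemma conv_ind_pos (ha : IsKernel a) (hYp : PeriodicSet Y) (hYo : IsOpen Y) {ξ : E d}
    (hξ : ξ ∈ closure Y) : 0 < conv a (ind Y) ξ := by
  have hY := isBddPeriodic_ind hYp hYo.measurableSet
  obtain ⟨r, hr, c, hc, hac⟩ := ha.lower_bound
  rw [conv, integral_pos_iff_support_of_nonneg
    (fun η => mul_nonneg (ha.nonneg _) (ind_nonneg _ _)) (integrable_conv ha.integrable hY ξ)]
  refine lt_of_lt_of_le ((Metric.isOpen_ball.inter hYo).measure_pos volume
    (mem_closure_iff_nhds.1 hξ _ (Metric.ball_mem_nhds ξ hr))) (measure_mono ?_)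
  rintro η ⟨hη, hηY⟩
  rw [Function.mem_support, ind_of_mem hηY, mul_one]
  refine (hc.trans_le (hac _ ?_)).ne'
  rw [← dist_eq_norm, dist_comm]
  exact (Metric.mem_ball.1 hη).le

lemma pair_conv_ind_pos (ha : IsKernel a) (hYp : PeriodicSet Y) (hYo : IsOpen Y)
    (hYn : Y.Nonempty) : 0 < pair (conv a (ind Y)) (ind Y) := by
  have hY := isBddPeriodic_ind hYp hYo.measurableSet
  have hnn : ∀ x, 0 ≤ conv a (ind Y) x := fun x =>
    integral_nonneg fun η => mul_nonneg (ha.nonneg _) (ind_nonneg _ _)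
  rw [pair, integral_pos_iff_support_of_nonneg (fun η => mul_nonneg (hnn _) (ind_nonneg _ _))
    ((isBddPeriodic_conv ha.integrable hY).mul hY).integrableOn]
  rw [Measure.restrict_apply' measurableSet_unitCell]
  refine (volume_inter_unitCell_pos hYp hYo hYn).trans_le (measure_mono ?_)
  rintro x ⟨hx, hx'⟩
  refine ⟨?_, hx'⟩
  rw [Function.mem_support, ind_of_mem hx, mul_one]
  exact (conv_ind_pos ha hYp hYo (subset_closure hx)).ne'

/-- The closure in `ℝ^d` of one period of `Y`: a compact set on which continuous functions serve as
unknowns of the cell problem. Nothing forces their values on opposite faces of the cell to agree;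
this holds automatically for solutions. -/
abbrev CellClosure (Y : Set (E d)) : Type := closure (Y ∩ unitCell d)

instance : CompactSpace (CellClosure Y) :=
  isCompact_iff_compactSpace.1
    ((isBounded_unitCell.subset Set.inter_subset_right).isCompact_closure)

section CellProblem

open BoundedContinuousFunction

/-- The periodic extension, by zero outside `Y`, of a function on the closure of one period. -/
def perExt (u : CellClosure Y →ᵇ ℝ) (x : E d) : ℝ :=
  ind Y x * Function.extend ((↑) : CellClosure Y → E d) u 0 (fracPt x)

lemma perExt_of_mem (hYp : PeriodicSet Y) (u : CellClosure Y →ᵇ ℝ) {x : E d} (hx : x ∈ Y) :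
    perExt u x = u ⟨fracPt x, subset_closure ⟨(hYp.fracPt_mem_iff x).2 hx, fracPt_mem x⟩⟩ := by
  rw [perExt, ind_of_mem hx, one_mul]
  exact Subtype.val_injective.extend_apply u 0
    ⟨fracPt x, subset_closure ⟨(hYp.fracPt_mem_iff x).2 hx, fracPt_mem x⟩⟩

lemma perExt_of_notMem (u : CellClosure Y →ᵇ ℝ) {x : E d} (hx : x ∉ Y) : perExt u x = 0 := by
  rw [perExt, ind_of_notMem hx, zero_mul]

lemma ind_mul_perExt (u : CellClosure Y →ᵇ ℝ) (x : E d) : ind Y x * perExt u x = perExt u x := by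
  by_cases hx : x ∈ Y
  · rw [ind_of_mem hx, one_mul]
  · rw [perExt_of_notMem u hx, mul_zero]

lemma abs_perExt_le (hYp : PeriodicSet Y) (u : CellClosure Y →ᵇ ℝ) (x : E d) :
    |perExt u x| ≤ ‖u‖ := by
  by_cases hx : x ∈ Y
  · rw [perExt_of_mem hYp u hx]
    exact u.norm_coe_le_norm _
  · rw [perExt_of_notMem u hx, abs_zero]
    exact norm_nonneg u

lemma isBddPeriodic_perExt (hYp : PeriodicSet Y) (hYo : IsOpen Y) (u : CellClosure Y →ᵇ ℝ) :
    IsBddPeriodic (perExt u) where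
  measurable :=
    (isBddPeriodic_ind hYp hYo.measurableSet).measurable.mul
      (((MeasurableEmbedding.subtype_coe isClosed_closure.measurableSet).measurable_extend
        u.continuous.measurable measurable_zero).comp measurable_fracPt)
  periodic n x := by
    rw [perExt, perExt, (isBddPeriodic_ind hYp hYo.measurableSet).periodic, fracPt_add]
  bounded := ⟨‖u‖, abs_perExt_le hYp u⟩

lemma perExt_add (hYp : PeriodicSet Y) (u v : CellClosure Y →ᵇ ℝ) :
    perExt (u + v) = fun x => perExt u x + perExt v x := by
  ext x
  by_cases hx : x ∈ Y
  · simp [perExt_of_mem hYp _ hx]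
  · simp [perExt_of_notMem _ hx]

lemma perExt_smul (hYp : PeriodicSet Y) (c : ℝ) (u : CellClosure Y →ᵇ ℝ) :
    perExt (c • u) = fun x => c * perExt u x := by
  ext x
  by_cases hx : x ∈ Y
  · simp [perExt_of_mem hYp _ hx]
  · simp [perExt_of_notMem _ hx]

lemma continuous_inv_conv_ind (ha : IsKernel a) (hYp : PeriodicSet Y) (hYo : IsOpen Y) :
    Continuous fun ξ : CellClosure Y => (conv a (ind Y) ξ)⁻¹ :=
  ((continuous_conv ha.integrable (isBddPeriodic_ind hYp hYo.measurableSet)).comp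
    continuous_subtype_val).inv₀
    fun ξ => (conv_ind_pos ha hYp hYo (closure_mono Set.inter_subset_left ξ.2)).ne'

/-- The jump operator `u ↦ (a * u) / (a * 1_Y)` of the cell problem, corrected by a rank one term
which removes the constants from the kernel of `1 - cellJump`. -/
def cellJump (ha : IsKernel a) (hYp : PeriodicSet Y) (hYo : IsOpen Y) :
    (CellClosure Y →ᵇ ℝ) →ₗ[ℝ] (CellClosure Y →ᵇ ℝ) where
  toFun u := mkOfCompact
    ⟨fun ξ => (conv a (ind Y) ξ)⁻¹ * conv a (perExt u) ξ - pair (conv a (ind Y)) (perExt u),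
      ((continuous_inv_conv_ind ha hYp hYo).mul ((continuous_conv ha.integrable
        (isBddPeriodic_perExt hYp hYo u)).comp continuous_subtype_val)).sub continuous_const⟩
  map_add' u v := by
    ext ξ
    have hu := isBddPeriodic_perExt hYp hYo u
    have hv := isBddPeriodic_perExt hYp hYo v
    simp only [mkOfCompact_apply, ContinuousMap.coe_mk, BoundedContinuousFunction.add_apply,
      perExt_add hYp, conv_add ha.integrable hu hv,
      pair_add (isBddPeriodic_conv ha.integrable (isBddPeriodic_ind hYp hYo.measurableSet)) hu hv]
    ring
  map_smul' c u := by
    ext ξ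
    simp only [mkOfCompact_apply, ContinuousMap.coe_mk, BoundedContinuousFunction.smul_apply,
      perExt_smul hYp, conv_const_mul, pair_const_mul, RingHom.id_apply, smul_eq_mul]
    ring

lemma cellJump_apply (ha : IsKernel a) (hYp : PeriodicSet Y) (hYo : IsOpen Y)
    (u : CellClosure Y →ᵇ ℝ) (ξ : CellClosure Y) :
    cellJump ha hYp hYo u ξ =
      (conv a (ind Y) ξ)⁻¹ * conv a (perExt u) ξ - pair (conv a (ind Y)) (perExt u) := rfl

lemma abs_pair_le {w v : E d → ℝ} (hw : IsBddPeriodic w) {C : ℝ} (hC : ∀ x, |v x| ≤ C) :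
    |pair w v| ≤ C * ∫ x in unitCell d, |w x| := by
  rw [pair, ← integral_const_mul, ← Real.norm_eq_abs]
  refine norm_integral_le_of_norm_le (hw.integrableOn.abs.const_mul C) (ae_of_all _ fun z => ?_)
  rw [Real.norm_eq_abs, abs_mul, mul_comm]
  exact mul_le_mul_of_nonneg_right (hC _) (abs_nonneg _)

lemma exists_cellJump_bound (ha : IsKernel a) (hYp : PeriodicSet Y) (hYo : IsOpen Y) :
    ∃ M, 0 ≤ M ∧ ∀ u, ‖cellJump ha hYp hYo u‖ ≤ M * ‖u‖ := by
  have hm := isBddPeriodic_conv ha.integrable (isBddPeriodic_ind hYp hYo.measurableSet)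
  set N : CellClosure Y →ᵇ ℝ := mkOfCompact ⟨_, continuous_inv_conv_ind ha hYp hYo⟩ with hN
  have hI : 0 ≤ ∫ z, |a z| := integral_nonneg fun _ => abs_nonneg _
  have hJ : 0 ≤ ∫ x in unitCell d, |conv a (ind Y) x| := integral_nonneg fun _ => abs_nonneg _
  refine ⟨‖N‖ * (∫ z, |a z|) + ∫ x in unitCell d, |conv a (ind Y) x|, by positivity, fun u => ?_⟩
  rw [BoundedContinuousFunction.norm_le (by positivity)]
  intro ξ
  rw [cellJump_apply]
  refine (norm_sub_le _ _).trans ?_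
  rw [norm_mul, Real.norm_eq_abs (conv a (perExt u) ξ), Real.norm_eq_abs (pair _ _)]
  have h1 : ‖(conv a (ind Y) ξ)⁻¹‖ ≤ ‖N‖ := N.norm_coe_le_norm ξ
  have h2 := abs_conv_le ha.integrable (abs_perExt_le hYp u) ξ
  have h3 := abs_pair_le hm (abs_perExt_le hYp u)
  have h4 := mul_le_mul h1 h2 (abs_nonneg _) (norm_nonneg _)
  calc _ ≤ _ := add_le_add h4 h3
    _ = _ := by ring

/-- Convolution with an integrable kernel maps bounded families to equicontinuous ones, so the jump
operator is compact by the Arzelà–Ascoli theorem. -/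
lemma isCompactOperator_cellJump (ha : IsKernel a) (hYp : PeriodicSet Y) (hYo : IsOpen Y) :
    IsCompactOperator (cellJump ha hYp hYo) := by
  rw [isCompactOperator_iff_isCompact_closure_image_closedBall _ zero_lt_one]
  obtain ⟨M, hM, hbound⟩ := exists_cellJump_bound ha hYp hYo
  have hI : 0 ≤ ∫ z, |a z| := integral_nonneg fun _ => abs_nonneg _
  refine arzela_ascoli (Metric.closedBall 0 M) (isCompact_closedBall 0 M) _ ?_ ?_
  · rintro _ ξ ⟨u, hu, rfl⟩
    rw [mem_closedBall_zero_iff] at hu ⊢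
    calc _ ≤ ‖cellJump ha hYp hYo u‖ := BoundedContinuousFunction.norm_coe_le_norm _ ξ
      _ ≤ M * ‖u‖ := hbound u
      _ ≤ M := by nlinarith
  · intro ξ₀
    set n : CellClosure Y → ℝ := fun ξ => (conv a (ind Y) ξ)⁻¹ with hn
    have hnc : Continuous n := continuous_inv_conv_ind ha hYp hYo
    have hsub : Tendsto (fun ξ : CellClosure Y => (ξ₀ : E d) - ξ) (𝓝 ξ₀) (𝓝 0) := by
      have : Continuous fun ξ : CellClosure Y => (ξ₀ : E d) - ξ := by fun_prop
      simpa using this.tendsto ξ₀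
    have l1 := ((tendsto_integral_abs_translate_sub ha.integrable).comp hsub).mul_const |n ξ₀|
    have l2 : Tendsto (fun ξ => (∫ z, |a z|) * |n ξ₀ - n ξ|) (𝓝 ξ₀) (𝓝 0) := by
      have : Continuous fun ξ => (∫ z, |a z|) * |n ξ₀ - n ξ| := by fun_prop
      simpa using this.tendsto ξ₀
    have l3 := l1.add l2
    rw [zero_mul, add_zero] at l3
    refine Metric.equicontinuousAt_of_continuity_modulus _ l3 _ (Eventually.of_forall fun ξ => ?_)
    rintro ⟨_, u, hu, rfl⟩
    rw [mem_closedBall_zero_iff] at hu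
    have hv := isBddPeriodic_perExt hYp hYo u
    have hv1 : ∀ x, |perExt u x| ≤ 1 := fun x => (abs_perExt_le hYp u x).trans hu
    have b1 := abs_conv_sub_conv_le ha.integrable hv hv1 (ξ₀ : E d) ξ
    have b2 := abs_conv_le ha.integrable hv1 (ξ : E d)
    rw [one_mul] at b1 b2
    change |cellJump ha hYp hYo u ξ₀ - cellJump ha hYp hYo u ξ| ≤ _
    rw [cellJump_apply, cellJump_apply]
    calc _ = |(conv a (perExt u) ξ₀ - conv a (perExt u) ξ) * n ξ₀
            + conv a (perExt u) ξ * (n ξ₀ - n ξ)| := by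
          congr 1; simp only [hn]; ring
      _ ≤ |conv a (perExt u) ξ₀ - conv a (perExt u) ξ| * |n ξ₀|
            + |conv a (perExt u) ξ| * |n ξ₀ - n ξ| := by
          refine (abs_add_le _ _).trans ?_
          rw [abs_mul, abs_mul]
      _ ≤ _ := add_le_add (mul_le_mul_of_nonneg_right b1 (abs_nonneg _))
          (mul_le_mul_of_nonneg_right b2 (abs_nonneg _))

/-- A solution of the corrected equation `u - cellJump u = -h / (a * 1_Y)` with compatible
right-hand side solves the uncorrected one: testing with `a * 1_Y` shows that the correction
vanishes. -/
lemma perExt_solves (ha : IsKernel a) (hYp : PeriodicSet Y) (hYo : IsOpen Y) (hYn : Y.Nonempty)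
    {h : E d → ℝ} (hh : IsBddPeriodic h) (h0 : pair (ind Y) h = 0) {u : CellClosure Y →ᵇ ℝ}
    (hu : ∀ ξ : CellClosure Y,
      u ξ - cellJump ha hYp hYo u ξ = -((conv a (ind Y) ξ)⁻¹ * h ξ)) :
    pair (conv a (ind Y)) (perExt u) = 0 ∧
      ∀ ξ ∈ Y, conv a (perExt u) ξ - conv a (ind Y) ξ * perExt u ξ = h ξ := by
  have hY := isBddPeriodic_ind hYp hYo.measurableSet
  have hm := isBddPeriodic_conv ha.integrable hY
  have hv := isBddPeriodic_perExt hYp hYo u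
  have hcv := isBddPeriodic_conv ha.integrable hv
  set L := pair (conv a (ind Y)) (perExt u) with hL
  have eqn : ∀ ξ ∈ Y, conv a (perExt u) ξ - conv a (ind Y) ξ * perExt u ξ =
      h ξ + L * conv a (ind Y) ξ := by
    intro ξ hξ
    have hξ' : fracPt ξ ∈ Y := (hYp.fracPt_mem_iff ξ).2 hξ
    have hpos := conv_ind_pos ha hYp hYo (subset_closure hξ)
    have := hu ⟨fracPt ξ, subset_closure ⟨hξ', fracPt_mem ξ⟩⟩
    rw [cellJump_apply, ← perExt_of_mem hYp u hξ] at this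
    simp only [hm.periodic.apply_fracPt, hcv.periodic.apply_fracPt, hh.periodic.apply_fracPt]
      at this
    have hinv := mul_inv_cancel₀ hpos.ne'
    linear_combination (-conv a (ind Y) ξ) * this + (h ξ - conv a (perExt u) ξ) * hinv
  have hL0 : L = 0 := by
    have e1 : pair (ind Y) (fun ξ => conv a (perExt u) ξ - conv a (ind Y) ξ * perExt u ξ) =
        pair (ind Y) (fun ξ => h ξ + L * conv a (ind Y) ξ) := by
      refine pair_congr fun ξ => ?_
      by_cases hξ : ξ ∈ Y
      · rw [eqn ξ hξ]
      · simp [ind_of_notMem hξ]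
    rw [pair_sub hY hcv (hm.mul hv), pair_add hY hh (hm.const_mul L), pair_const_mul, h0,
      pair_conv_of_even ha.integrable ha.symm hv hY] at e1
    have e2 : pair (ind Y) (fun ξ => conv a (ind Y) ξ * perExt u ξ) =
        pair (perExt u) (conv a (ind Y)) :=
      pair_congr fun ξ => by linear_combination conv a (ind Y) ξ * ind_mul_perExt u ξ
    rw [e2, sub_self, zero_add, pair_comm (ind Y)] at e1
    exact (mul_eq_zero.1 e1.symm).resolve_right (pair_conv_ind_pos ha hYp hYo hYn).ne'
  refine ⟨hL0, fun ξ hξ => ?_⟩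
  rw [eqn ξ hξ, hL0, zero_mul, add_zero]

lemma continuousOn_of_solves (ha : IsKernel a) (hYp : PeriodicSet Y) (hYo : IsOpen Y)
    {v h : E d → ℝ} (hv : IsBddPeriodic v) (hhc : Continuous h)
    (hs : ∀ ξ ∈ Y, conv a v ξ - conv a (ind Y) ξ * v ξ = h ξ) : ContinuousOn v Y := by
  have hY := isBddPeriodic_ind hYp hYo.measurableSet
  have hpos : ∀ ξ ∈ Y, conv a (ind Y) ξ ≠ 0 := fun ξ hξ =>
    (conv_ind_pos ha hYp hYo (subset_closure hξ)).ne'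
  refine ContinuousOn.congr (f := fun ξ => (conv a v ξ - h ξ) / conv a (ind Y) ξ)
    (((continuous_conv ha.integrable hv).sub hhc).continuousOn.div
      (continuous_conv ha.integrable hY).continuousOn hpos) fun ξ hξ => ?_
  simp only
  rw [eq_div_iff (hpos ξ hξ), ← hs ξ hξ]
  ring

/-- Fredholm solvability of the cell problem: a continuous right-hand side with mean zero over `Y`
is attained. -/
theorem exists_solution (ha : IsKernel a) (hYp : PeriodicSet Y) (hYo : IsOpen Y)
    (hYn : Y.Nonempty) (hconn : JumpConnected a Y) {h : E d → ℝ} (hh : IsBddPeriodic h)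
    (hhc : Continuous h) (h0 : pair (ind Y) h = 0) :
    ∃ v : E d → ℝ, IsBddPeriodic v ∧ (∀ x, ind Y x * v x = v x) ∧ ContinuousOn v Y ∧
      ∀ ξ ∈ Y, conv a v ξ - conv a (ind Y) ξ * v ξ = h ξ := by
  have hY := isBddPeriodic_ind hYp hYo.measurableSet
  have hm := isBddPeriodic_conv ha.integrable hY
  obtain ⟨M, hM, hbound⟩ := exists_cellJump_bound ha hYp hYo
  set T : (CellClosure Y →ᵇ ℝ) →L[ℝ] (CellClosure Y →ᵇ ℝ) :=
    (cellJump ha hYp hYo).mkContinuous M hbound with hT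
  have hTc : IsCompactOperator T := isCompactOperator_cellJump ha hYp hYo
  have hTa : ∀ u, T u = cellJump ha hYp hYo u := fun u => rfl
  rcases hTc.hasEigenvalue_or_mem_resolventSet one_ne_zero with hev | hres
  · exfalso
    obtain ⟨u, hu⟩ := hev.exists_hasEigenvector
    have hTu : T u = u := by simpa using hu.apply_eq_smul
    have hu0 : ∀ ξ : CellClosure Y, u ξ - cellJump ha hYp hYo u ξ =
        -((conv a (ind Y) ξ)⁻¹ * (fun _ : E d => (0 : ℝ)) ξ) := by
      intro ξ
      rw [← hTa, hTu]; simp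
    have hv := isBddPeriodic_perExt hYp hYo u
    obtain ⟨hL, hs⟩ := perExt_solves ha hYp hYo hYn (IsBddPeriodic.const 0) (by simp [pair]) hu0
    have hc := continuousOn_of_solves ha hYp hYo hv continuous_const hs
    -- Without a linear part, the total energy is twice `⟨u, (a * 1_Y) u - a * u⟩`.
    have hE : pair (ind Y) (energyDensity a Y 0 (perExt u)) = 0 := by
      rw [pair_energyDensity ha hY hv (ind_mul_perExt u)]
      have e : pair (perExt u) (fun ξ => conv a (ind Y) ξ * perExt u ξ) =
          pair (perExt u) (conv a (perExt u)) := by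
        refine pair_congr fun ξ => ?_
        by_cases hξ : ξ ∈ Y
        · rw [← sub_eq_zero.1 (hs ξ hξ)]
        · simp [perExt_of_notMem u hξ]
      rw [e]
      simp [pair, conv]
    have hz := eq_zero_of_pair_ind_eq_zero hYo hY
      (isBddPeriodic_energyDensity ha hY hv (ind_mul_perExt u) 0) (energyDensity_nonneg ha 0)
      (continuousOn_energyDensity ha hY hv (ind_mul_perExt u) hc 0) hE
    have hconst := eq_of_energyDensity_eq_zero ha hYo hY hconn hv (ind_mul_perExt u) hc 0 hz
    obtain ⟨x₀, hx₀⟩ := hYn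
    have hvc : perExt u = fun x => perExt u x₀ * ind Y x := by
      ext x
      by_cases hx : x ∈ Y
      · simpa [ind_of_mem hx] using hconst x hx x₀ hx₀
      · rw [perExt_of_notMem u hx, ind_of_notMem hx, mul_zero]
    -- The constant is annihilated by the rank one correction, whose value on `1_Y` is positive.
    have hL' := hL
    rw [hvc, pair_const_mul] at hL'
    have hc0 := (mul_eq_zero.1 hL').resolve_right
      (pair_conv_ind_pos ha hYp hYo ⟨x₀, hx₀⟩).ne'
    have hv0 : perExt u = fun _ => 0 := by
      rw [hvc, hc0]; simp
    -- The periodic extension ignores `u` on the boundary of `Y`; there the equation gives `u = 0`.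
    refine hu.2 ?_
    ext ξ
    have := hu0 ξ
    rw [cellJump_apply, hL, hv0] at this
    simpa [conv] using this
  · rw [spectrum.mem_resolventSet_iff, ContinuousLinearMap.isUnit_iff_bijective] at hres
    obtain ⟨u, hu⟩ := hres.2 (mkOfCompact ⟨fun ξ => -((conv a (ind Y) ξ)⁻¹ * h ξ),
      ((continuous_inv_conv_ind ha hYp hYo).mul (hhc.comp continuous_subtype_val)).neg⟩)
    have hu' : ∀ ξ : CellClosure Y,
        u ξ - cellJump ha hYp hYo u ξ = -((conv a (ind Y) ξ)⁻¹ * h ξ) := by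
      intro ξ
      have := congrArg (fun w : CellClosure Y →ᵇ ℝ => w ξ) hu
      simpa [hTa] using this
    obtain ⟨-, hs⟩ := perExt_solves ha hYp hYo hYn hh h0 hu'
    have hv := isBddPeriodic_perExt hYp hYo u
    exact ⟨perExt u, hv, ind_mul_perExt u, continuousOn_of_solves ha hYp hYo hv hhc hs, hs⟩

end CellProblem

/-! ### The correctors and the effective matrix -/

lemma setIntegral_eq_integral_ind_mul {S : Set (E d)} (hS : MeasurableSet S) (f : E d → ℝ) :
    ∫ x in S, f x = ∫ x, ind S x * f x := by
  rw [← integral_indicator hS]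
  congr 1; ext x
  by_cases hx : x ∈ S <;> simp [ind, hx]

lemma setIntegral_inter_unitCell {S : Set (E d)} (hS : MeasurableSet S) (f : E d → ℝ) :
    ∫ x in S ∩ unitCell d, f x = ∫ x in unitCell d, ind S x * f x := by
  rw [Set.inter_comm, ← setIntegral_indicator hS]
  congr 1; ext x
  by_cases hx : x ∈ S <;> simp [ind, hx]

lemma pair_ind_const (hS : MeasurableSet Y) (c : ℝ) :
    pair (ind Y) (fun _ => c) = volume.real (Y ∩ unitCell d) * c := by
  rw [pair, ← setIntegral_inter_unitCell hS, setIntegral_const, smul_eq_mul]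

lemma cellOp_eq (ha : IsKernel a) (hYp : PeriodicSet Y) (hYo : IsOpen Y) {u : E d → ℝ}
    (hu : IsBddPeriodic u) (huY : ∀ x, ind Y x * u x = u x) (ξ : E d) :
    cellOp a Y u ξ = conv a u ξ - conv a (ind Y) ξ * u ξ := by
  have hY := isBddPeriodic_ind hYp hYo.measurableSet
  rw [cellOp, setIntegral_inter_unitCell hYo.measurableSet]
  have e : ∀ η, ind Y η * (periodization a (ξ - η) * (u η - u ξ)) =
      periodization a (ξ - η) * (u η - u ξ * ind Y η) := fun η => by
    linear_combination periodization a (ξ - η) * huY η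
  simp only [e]
  rw [setIntegral_periodization ha.integrable (hu.sub (hY.const_mul (u ξ))),
    conv_sub ha.integrable hu (hY.const_mul (u ξ)), conv_const_mul]
  ring

/-- The first moment kernel `a(z) z_i`. -/
def kernel₁ (a : E d → ℝ) (i : Fin d) (z : E d) : ℝ := a z * z i

/-- The second moment kernel `a(z) z_i z_j`. -/
def kernel₂ (a : E d → ℝ) (i j : Fin d) (z : E d) : ℝ := a z * (z i * z j)

lemma integrable_kernel₁ (ha : IsKernel a) (i : Fin d) : Integrable (kernel₁ a i) :=
  ha.integrable_mul_linear (EuclideanSpace.proj i)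

lemma integrable_kernel₂ (ha : IsKernel a) (i j : Fin d) : Integrable (kernel₂ a i j) :=
  ha.integrable_mul_linear_mul (EuclideanSpace.proj i) (EuclideanSpace.proj j)

lemma kernel₁_neg (ha : IsKernel a) (i : Fin d) (z : E d) : kernel₁ a i (-z) = -kernel₁ a i z := by
  simp [kernel₁, ha.symm]

/-- `φ` consists of correctors of first order: bounded periodic functions, zero outside `Y`, which
are continuous on `Y` and solve the first cell problem. -/
structure IsFirstCorrector (a : E d → ℝ) (Y : Set (E d)) (φ : E d → Fin d → ℝ) : Prop where
  bddPeriodic : ∀ i, IsBddPeriodic fun x => φ x i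
  ind_mul : ∀ i x, ind Y x * φ x i = φ x i
  continuousOn : ∀ i, ContinuousOn (fun x => φ x i) Y
  solves : ∀ i, ∀ ξ ∈ Y, conv a (fun x => φ x i) ξ - conv a (ind Y) ξ * φ ξ i =
    conv (kernel₁ a i) (ind Y) ξ

/-- The mean value zero condition for the first cell problem holds because the first moment kernel
is odd. -/
lemma exists_isFirstCorrector (ha : IsKernel a) (hYp : PeriodicSet Y) (hYo : IsOpen Y)
    (hYn : Y.Nonempty) (hconn : JumpConnected a Y) : ∃ φ, IsFirstCorrector a Y φ := by
  have hY := isBddPeriodic_ind hYp hYo.measurableSet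
  have h0 : ∀ i, pair (ind Y) (conv (kernel₁ a i) (ind Y)) = 0 := fun i => by
    have := pair_conv_of_odd (integrable_kernel₁ ha i) (kernel₁_neg ha i) hY hY
    linarith
  choose φ h1 h2 h3 h4 using fun i => exists_solution ha hYp hYo hYn hconn
    (isBddPeriodic_conv (integrable_kernel₁ ha i) hY)
    (continuous_conv (integrable_kernel₁ ha i) hY) (h0 i)
  exact ⟨fun x i => φ i x, h1, h2, h3, h4⟩

lemma setIntegral_firstMoment (hYo : IsOpen Y) (i : Fin d) (ξ : E d) :
    -∫ η in Y, a (ξ - η) * (η - ξ) i = conv (kernel₁ a i) (ind Y) ξ := by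
  rw [setIntegral_eq_integral_ind_mul hYo.measurableSet, ← integral_neg, conv]
  congr 1; ext η
  simp only [kernel₁, PiLp.sub_apply]
  ring

/-- The integral `∫_Y a(ξ-η) [½ (ξ-η)_i (ξ-η)_j - (ξ-η)_i φ_j(η)] dη`, written with convolutions; as
`φ` vanishes outside `Y`, the second one needs no indicator function. -/
def effDensity (a : E d → ℝ) (Y : Set (E d)) (φ : E d → Fin d → ℝ) (i j : Fin d) (ξ : E d) : ℝ :=
  1 / 2 * conv (kernel₂ a i j) (ind Y) ξ - conv (kernel₁ a i) (fun x => φ x j) ξ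

/-- The effective matrix, as the mean value over `Y` of the effective density. -/
def effMatrix (a : E d → ℝ) (Y : Set (E d)) (φ : E d → Fin d → ℝ) : Matrix (Fin d) (Fin d) ℝ :=
  Matrix.of fun i j => (volume.real (Y ∩ unitCell d))⁻¹ * pair (ind Y) (effDensity a Y φ i j)

section Effective

variable {φ : E d → Fin d → ℝ}

lemma ind_mul_effIntegrand (hφ : IsFirstCorrector a Y φ) (i j : Fin d) (ξ η : E d) :
    ind Y η * effIntegrand a φ i j ξ η =
      1 / 2 * (kernel₂ a i j (ξ - η) * ind Y η) - kernel₁ a i (ξ - η) * φ η j := by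
  simp only [effIntegrand, kernel₁, kernel₂]
  linear_combination (-(a (ξ - η) * (ξ - η) i)) * hφ.ind_mul j η

lemma setIntegral_effIntegrand (ha : IsKernel a) (hYp : PeriodicSet Y) (hYo : IsOpen Y)
    (hφ : IsFirstCorrector a Y φ) (i j : Fin d) (ξ : E d) :
    ∫ η in Y, effIntegrand a φ i j ξ η = effDensity a Y φ i j ξ := by
  have hY := isBddPeriodic_ind hYp hYo.measurableSet
  rw [setIntegral_eq_integral_ind_mul hYo.measurableSet]
  simp only [ind_mul_effIntegrand hφ]
  rw [integral_sub ((integrable_conv (integrable_kernel₂ ha i j) hY ξ).const_mul _)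
    (integrable_conv (integrable_kernel₁ ha i) (hφ.bddPeriodic j) ξ), integral_const_mul]
  rfl

lemma isBddPeriodic_effDensity (ha : IsKernel a) (hYp : PeriodicSet Y) (hYo : IsOpen Y)
    (hφ : IsFirstCorrector a Y φ) (i j : Fin d) : IsBddPeriodic (effDensity a Y φ i j) :=
  ((isBddPeriodic_conv (integrable_kernel₂ ha i j)
    (isBddPeriodic_ind hYp hYo.measurableSet)).const_mul (1 / 2)).sub
    (isBddPeriodic_conv (integrable_kernel₁ ha i) (hφ.bddPeriodic j))

lemma continuous_effDensity (ha : IsKernel a) (hYp : PeriodicSet Y) (hYo : IsOpen Y)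
    (hφ : IsFirstCorrector a Y φ) (i j : Fin d) : Continuous (effDensity a Y φ i j) :=
  ((continuous_conv (integrable_kernel₂ ha i j)
    (isBddPeriodic_ind hYp hYo.measurableSet)).const_mul (1 / 2)).sub
    (continuous_conv (integrable_kernel₁ ha i) (hφ.bddPeriodic j))

lemma volume_real_inter_unitCell_pos (hYp : PeriodicSet Y) (hYo : IsOpen Y) (hYn : Y.Nonempty) :
    0 < volume.real (Y ∩ unitCell d) :=
  ENNReal.toReal_pos (volume_inter_unitCell_pos hYp hYo hYn).ne'
    ((measure_mono Set.inter_subset_right).trans_lt volume_unitCell_lt_top).ne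

lemma volume_mul_effMatrix (hYp : PeriodicSet Y) (hYo : IsOpen Y) (hYn : Y.Nonempty)
    (i j : Fin d) :
    volume.real (Y ∩ unitCell d) * effMatrix a Y φ i j = pair (ind Y) (effDensity a Y φ i j) :=
  mul_inv_cancel_left₀ (volume_real_inter_unitCell_pos hYp hYo hYn).ne' _

lemma pair_effDensity (ha : IsKernel a) (hYp : PeriodicSet Y) (hYo : IsOpen Y)
    (hφ : IsFirstCorrector a Y φ) (i j : Fin d) :
    pair (ind Y) (effDensity a Y φ i j) = 1 / 2 * pair (ind Y) (conv (kernel₂ a i j) (ind Y))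
      - pair (ind Y) (conv (kernel₁ a i) fun x => φ x j) := by
  have hY := isBddPeriodic_ind hYp hYo.measurableSet
  have p := isBddPeriodic_conv (integrable_kernel₂ ha i j) hY
  rw [← pair_const_mul, ← pair_sub hY (p.const_mul _)
    (isBddPeriodic_conv (integrable_kernel₁ ha i) (hφ.bddPeriodic j))]
  rfl

/-- The cell formula, with the inner integral over one period of `Y`. -/
lemma integral_setIntegral_effIntegrand (ha : IsKernel a) (hYp : PeriodicSet Y) (hYo : IsOpen Y)
    (hφ : IsFirstCorrector a Y φ) (i j : Fin d) :
    ∫ ξ in Y, ∫ η in Y ∩ unitCell d, effIntegrand a φ i j ξ η =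
      pair (ind Y) (effDensity a Y φ i j) := by
  have hY := isBddPeriodic_ind hYp hYo.measurableSet
  have k1 := integrable_kernel₁ ha i
  have k2 := integrable_kernel₂ ha i j
  rw [setIntegral_eq_integral_ind_mul hYo.measurableSet]
  have e : ∀ ξ, ind Y ξ * ∫ η in Y ∩ unitCell d, effIntegrand a φ i j ξ η =
      1 / 2 * (ind Y ξ * ∫ η in unitCell d, kernel₂ a i j (ξ - η) * ind Y η)
        - ind Y ξ * ∫ η in unitCell d, kernel₁ a i (ξ - η) * φ η j := by
    intro ξ
    rw [setIntegral_inter_unitCell hYo.measurableSet]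
    simp only [ind_mul_effIntegrand hφ]
    rw [integral_sub (((integrable_conv k2 hY ξ).const_mul _).integrableOn)
      (integrable_conv k1 (hφ.bddPeriodic j) ξ).integrableOn, integral_const_mul]
    ring
  simp only [e]
  have i1 := (integrable_cell_prod k2 hY hY).integral_prod_left
  have i2 := (integrable_cell_prod k1 (hφ.bddPeriodic j) hY).integral_prod_left
  simp only [integral_const_mul] at i1 i2
  rw [integral_sub (i1.const_mul _) i2, integral_const_mul, integral_mul_setIntegral_cell k2 hY hY,
    integral_mul_setIntegral_cell k1 (hφ.bddPeriodic j) hY, pair_effDensity ha hYp hYo hφ]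

/-- Solvability of the second cell problem: the effective matrix is the constant for which the
right-hand side has mean value zero. -/
lemma exists_secondCorrector (ha : IsKernel a) (hYp : PeriodicSet Y) (hYo : IsOpen Y)
    (hYn : Y.Nonempty) (hconn : JumpConnected a Y) (hφ : IsFirstCorrector a Y φ) :
    ∃ ϰ : E d → Matrix (Fin d) (Fin d) ℝ, ∀ i j, IsBddPeriodic (fun x => ϰ x i j) ∧
      (∀ x, ind Y x * ϰ x i j = ϰ x i j) ∧ ContinuousOn (fun x => ϰ x i j) Y ∧
      ∀ ξ ∈ Y, conv a (fun x => ϰ x i j) ξ - conv a (ind Y) ξ * ϰ ξ i j =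
        effMatrix a Y φ i j - effDensity a Y φ i j ξ := by
  have hY := isBddPeriodic_ind hYp hYo.measurableSet
  have hD := isBddPeriodic_effDensity ha hYp hYo hφ
  have h0 : ∀ i j, pair (ind Y) (fun ξ => effMatrix a Y φ i j - effDensity a Y φ i j ξ) = 0 := by
    intro i j
    rw [pair_sub hY (IsBddPeriodic.const _) (hD i j), pair_ind_const hYo.measurableSet,
      volume_mul_effMatrix hYp hYo hYn, sub_self]
  choose k h using fun i j => exists_solution ha hYp hYo hYn hconn
    ((IsBddPeriodic.const (effMatrix a Y φ i j)).sub (hD i j))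
    (continuous_const.sub (continuous_effDensity ha hYp hYo hφ i j)) (h0 i j)
  exact ⟨fun x => Matrix.of fun i j => k i j x, h⟩

/-- Testing the first cell problem for `φ_i` with `φ_j` turns the nonsymmetric term of the cell
formula into the Dirichlet form of the correctors, which is symmetric. -/
lemma pair_kernel₁_corrector (ha : IsKernel a) (hYp : PeriodicSet Y) (hYo : IsOpen Y)
    (hφ : IsFirstCorrector a Y φ) (i j : Fin d) :
    pair (ind Y) (conv (kernel₁ a i) fun x => φ x j) =
      pair (fun x => φ x j) (fun ξ => conv a (ind Y) ξ * φ ξ i)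
        - pair (fun x => φ x j) (conv a fun x => φ x i) := by
  have hY := isBddPeriodic_ind hYp hYo.measurableSet
  have hc := isBddPeriodic_conv ha.integrable hY
  rw [pair_conv_of_odd (integrable_kernel₁ ha i) (kernel₁_neg ha i) (hφ.bddPeriodic j) hY,
    ← pair_sub (hφ.bddPeriodic j) (hc.mul (hφ.bddPeriodic i))
      (isBddPeriodic_conv ha.integrable (hφ.bddPeriodic i)), ← neg_one_mul, ← pair_const_mul]
  refine pair_congr fun ξ => ?_
  by_cases hξ : ξ ∈ Y
  · rw [← hφ.solves i ξ hξ]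
    ring
  · rw [← hφ.ind_mul j, ind_of_notMem hξ]
    ring

lemma effMatrix_symm (ha : IsKernel a) (hYp : PeriodicSet Y) (hYo : IsOpen Y)
    (hφ : IsFirstCorrector a Y φ) (i j : Fin d) :
    effMatrix a Y φ i j = effMatrix a Y φ j i := by
  have e1 : kernel₂ a i j = kernel₂ a j i := by
    ext z; simp only [kernel₂]; ring
  have e2 : pair (fun x => φ x j) (fun ξ => conv a (ind Y) ξ * φ ξ i) =
      pair (fun x => φ x i) (fun ξ => conv a (ind Y) ξ * φ ξ j) :=
    pair_congr fun x => by ring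
  simp only [effMatrix, Matrix.of_apply]
  rw [pair_effDensity ha hYp hYo hφ, pair_effDensity ha hYp hYo hφ,
    pair_kernel₁_corrector ha hYp hYo hφ, pair_kernel₁_corrector ha hYp hYo hφ, e1, e2,
    pair_conv_of_even ha.integrable ha.symm (hφ.bddPeriodic i) (hφ.bddPeriodic j)]

/-- The linear form with coefficients `v`. -/
def coordForm (v : Fin d → ℝ) : E d →L[ℝ] ℝ := ∑ i, v i • (EuclideanSpace.proj i : E d →L[ℝ] ℝ)

lemma coordForm_apply (v : Fin d → ℝ) (z : E d) : coordForm v z = ∑ i, v i * z i := by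
  simp [coordForm]

/-- The quadratic form of the effective matrix is half the energy of the corrected linear form
`v · ξ + v · φ(ξ)`. -/
lemma quadraticForm_effMatrix (ha : IsKernel a) (hYp : PeriodicSet Y) (hYo : IsOpen Y)
    (hYn : Y.Nonempty) (hφ : IsFirstCorrector a Y φ) (v : Fin d → ℝ) :
    volume.real (Y ∩ unitCell d) * ∑ i, ∑ j, v i * effMatrix a Y φ i j * v j =
      1 / 2 * pair (ind Y) (energyDensity a Y (coordForm v) fun x => ∑ i, v i * φ x i) := by
  have hY := isBddPeriodic_ind hYp hYo.measurableSet
  set ℓ := coordForm v with hℓ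
  set ψ : E d → ℝ := fun x => ∑ i, v i * φ x i with hψ
  have hψb : IsBddPeriodic ψ :=
    IsBddPeriodic.sum _ fun i _ => (hφ.bddPeriodic i).const_mul (v i)
  have hψY : ∀ x, ind Y x * ψ x = ψ x := fun x => by
    simp only [hψ, Finset.mul_sum]
    exact Finset.sum_congr rfl fun i _ => by linear_combination v i * hφ.ind_mul i x
  have k1 := ha.integrable_mul_linear ℓ
  have k2 := ha.integrable_mul_linear_mul ℓ ℓ
  have hc := isBddPeriodic_conv ha.integrable hY
  have s1 : ∀ u, IsBddPeriodic u → ∀ ξ,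
      conv (fun z => a z * ℓ z) u ξ = ∑ i, v i * conv (kernel₁ a i) u ξ := by
    intro u hu ξ
    simp only [conv, ← integral_const_mul]
    rw [← integral_finsetSum _ fun i _ =>
      (integrable_conv (integrable_kernel₁ ha i) hu ξ).const_mul (v i)]
    congr 1; ext η
    simp only [hℓ, coordForm_apply, kernel₁, Finset.mul_sum, Finset.sum_mul]
    exact Finset.sum_congr rfl fun i _ => by ring
  have s2 : ∀ ξ, conv (fun z => a z * (ℓ z * ℓ z)) (ind Y) ξ =
      ∑ i, ∑ j, v i * v j * conv (kernel₂ a i j) (ind Y) ξ := by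
    intro ξ
    simp only [conv, ← integral_const_mul]
    have hi : ∀ i j, Integrable fun η => v i * v j * (kernel₂ a i j (ξ - η) * ind Y η) :=
      fun i j => (integrable_conv (integrable_kernel₂ ha i j) hY ξ).const_mul _
    simp_rw [← integral_finsetSum _ fun j _ => hi _ j]
    rw [← integral_finsetSum _ fun i _ => integrable_finsetSum _ fun j _ => hi i j]
    congr 1; ext η
    simp only [hℓ, coordForm_apply, kernel₂, Finset.mul_sum, Finset.sum_mul]
    rw [Finset.sum_comm]
    exact Finset.sum_congr rfl fun i _ => Finset.sum_congr rfl fun j _ => by ring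
  -- By linearity, `ψ` solves the cell problem with the first moment kernel in direction `v`.
  have hsol : ∀ ξ ∈ Y,
      conv a ψ ξ - conv a (ind Y) ξ * ψ ξ = conv (fun z => a z * ℓ z) (ind Y) ξ := by
    intro ξ hξ
    rw [s1 _ hY, hψ, conv_sum _ ha.integrable
      (fun i _ => (hφ.bddPeriodic i).const_mul (v i)), Finset.mul_sum, ← Finset.sum_sub_distrib]
    refine Finset.sum_congr rfl fun i _ => ?_
    rw [conv_const_mul, ← hφ.solves i ξ hξ]
    ring
  have hQ : volume.real (Y ∩ unitCell d) * ∑ i, ∑ j, v i * effMatrix a Y φ i j * v j =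
      pair (ind Y) (fun ξ => 1 / 2 * conv (fun z => a z * (ℓ z * ℓ z)) (ind Y) ξ
        - conv (fun z => a z * ℓ z) ψ ξ) := by
    have e : (fun ξ => 1 / 2 * conv (fun z => a z * (ℓ z * ℓ z)) (ind Y) ξ
        - conv (fun z => a z * ℓ z) ψ ξ) =
        fun ξ => ∑ i, ∑ j, v i * v j * effDensity a Y φ i j ξ := by
      ext ξ
      rw [s2, s1 _ hψb]
      simp only [hψ]
      simp_rw [conv_sum Finset.univ (integrable_kernel₁ ha _)
        (fun i _ => (hφ.bddPeriodic i).const_mul (v i)), conv_const_mul, Finset.mul_sum,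
        ← Finset.sum_sub_distrib, effDensity]
      exact Finset.sum_congr rfl fun i _ => Finset.sum_congr rfl fun j _ => by ring
    have hb : ∀ i j, IsBddPeriodic fun ξ => v i * v j * effDensity a Y φ i j ξ := fun i j =>
      (isBddPeriodic_effDensity ha hYp hYo hφ i j).const_mul _
    rw [e, pair_sum _ hY fun i _ => IsBddPeriodic.sum _ fun j _ => hb i j, Finset.mul_sum]
    refine Finset.sum_congr rfl fun i _ => ?_
    rw [pair_sum _ hY fun j _ => hb i j, Finset.mul_sum]
    refine Finset.sum_congr rfl fun j _ => ?_
    rw [pair_const_mul, ← volume_mul_effMatrix hYp hYo hYn]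
    ring
  have hodd : pair (ind Y) (conv (fun z => a z * ℓ z) ψ) =
      -pair ψ (conv (fun z => a z * ℓ z) (ind Y)) :=
    pair_conv_of_odd k1 (fun z => by rw [ha.symm, map_neg, mul_neg]) hψb hY
  have hdir : pair ψ (fun ξ => conv a (ind Y) ξ * ψ ξ) - pair ψ (conv a ψ) =
      -pair ψ (conv (fun z => a z * ℓ z) (ind Y)) := by
    rw [← pair_sub hψb (hc.mul hψb) (isBddPeriodic_conv ha.integrable hψb), ← neg_one_mul,
      ← pair_const_mul]
    refine pair_congr fun ξ => ?_
    by_cases hξ : ξ ∈ Y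
    · rw [← hsol ξ hξ]
      ring
    · rw [← hψY, ind_of_notMem hξ]
      ring
  rw [hQ, pair_energyDensity ha hY hψb hψY, hdir,
    pair_sub hY ((isBddPeriodic_conv k2 hY).const_mul _) (isBddPeriodic_conv k1 hψb),
    pair_const_mul, hodd]
  ring

/-- The effective matrix is positive definite: if the energy of `v · ξ + v · φ(ξ)` vanished, this
function would be constant on `Y`, which is impossible as `φ` is periodic and `Y` is invariant under
the translations by the unit vectors. -/
theorem posDef_effMatrix (ha : IsKernel a) (hYp : PeriodicSet Y) (hYo : IsOpen Y)
    (hYn : Y.Nonempty) (hconn : JumpConnected a Y) (hφ : IsFirstCorrector a Y φ) :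
    (effMatrix a Y φ).PosDef := by
  have hY := isBddPeriodic_ind hYp hYo.measurableSet
  rw [Matrix.posDef_iff_dotProduct_mulVec]
  refine ⟨Matrix.IsHermitian.ext fun i j => effMatrix_symm ha hYp hYo hφ j i, fun v hv => ?_⟩
  have hψb : IsBddPeriodic fun x => ∑ i, v i * φ x i :=
    IsBddPeriodic.sum _ fun i _ => (hφ.bddPeriodic i).const_mul (v i)
  have hψY : ∀ x, ind Y x * ∑ i, v i * φ x i = ∑ i, v i * φ x i := fun x => by
    simp only [Finset.mul_sum]
    exact Finset.sum_congr rfl fun i _ => by linear_combination v i * hφ.ind_mul i x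
  have hψc : ContinuousOn (fun x => ∑ i, v i * φ x i) Y :=
    continuousOn_finsetSum _ fun i _ => (hφ.continuousOn i).const_mul (v i)
  have hvol := volume_real_inter_unitCell_pos hYp hYo hYn
  have hq := quadraticForm_effMatrix ha hYp hYo hYn hφ v
  have hqf : star v ⬝ᵥ (effMatrix a Y φ).mulVec v = ∑ i, ∑ j, v i * effMatrix a Y φ i j * v j := by
    simp only [dotProduct, Matrix.mulVec, Finset.mul_sum, Pi.star_apply, star_trivial, mul_assoc]
  rw [hqf]
  refine pos_of_mul_pos_right (a := volume.real (Y ∩ unitCell d)) ?_ hvol.le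
  rw [hq]
  refine mul_pos (by norm_num)
    (lt_of_le_of_ne (pair_energyDensity_nonneg ha _) fun hzero => hv ?_)
  have hz := eq_zero_of_pair_ind_eq_zero hYo hY
    (isBddPeriodic_energyDensity ha hY hψb hψY (coordForm v)) (energyDensity_nonneg ha _)
    (continuousOn_energyDensity ha hY hψb hψY hψc _) hzero.symm
  have hconst := eq_of_energyDensity_eq_zero ha hYo hY hconn hψb hψY hψc (coordForm v) hz
  obtain ⟨x₀, hx₀⟩ := hYn
  ext k
  have h := hconst _ ((hYp (Pi.single k 1) x₀).2 hx₀) x₀ hx₀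
  have hper := hψb.periodic (Pi.single k 1) x₀
  rw [hper, map_add] at h
  have h' : coordForm v (latticePt (Pi.single k 1)) = 0 := by linarith
  rw [coordForm_apply] at h'
  simpa [latticePt, Pi.single_apply] using h'

end Effective

/-! ### Taylor expansion of Schwartz functions -/

/-- The partial derivative of a Schwartz function, as a Schwartz function. -/
def schwartzD (i : Fin d) (f : 𝓢(E d, ℝ)) : 𝓢(E d, ℝ) :=
  LineDeriv.lineDerivOp (EuclideanSpace.single i (1 : ℝ)) f

lemma partialD_eq (i : Fin d) (f : 𝓢(E d, ℝ)) : partialD i f = schwartzD i f := by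
  ext x
  exact (SchwartzMap.lineDerivOp_apply_eq_fderiv (EuclideanSpace.single i (1 : ℝ)) f x).symm

lemma exists_schwartz_bound (f : 𝓢(E d, ℝ)) : ∃ C, 0 ≤ C ∧ ∀ x, |f x| ≤ C := by
  obtain ⟨C, hC, h⟩ := f.decay 0 0
  exact ⟨C, hC.le, fun x => by simpa using h x⟩

lemma hasDerivAt_schwartz_line (f : 𝓢(E d, ℝ)) (x h : E d) (t : ℝ) :
    HasDerivAt (fun t : ℝ => f (x + t • h)) (∑ i, h i * schwartzD i f (x + t • h)) t := by
  have h1 : HasDerivAt (fun t : ℝ => x + t • h) h t := by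
    simpa using ((hasDerivAt_id t).smul_const h).const_add x
  have h2 := (f.differentiableAt (x := x + t • h)).hasFDerivAt.comp_hasDerivAt t h1
  refine h2.congr_deriv ?_
  have hh : h = ∑ i, h i • EuclideanSpace.single i (1 : ℝ) := by
    ext j
    simp [Pi.single_apply]
  refine (congrArg (fderiv ℝ f (x + t • h)) hh).trans ?_
  rw [map_sum]
  refine Finset.sum_congr rfl fun i _ => ?_
  rw [map_smul, smul_eq_mul, ← partialD_eq]
  rfl

lemma abs_sum_coord_mul_le (h : E d) {r C : Fin d → ℝ} (hr : ∀ i, |r i| ≤ C i) :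
    |∑ i, h i * r i| ≤ (∑ i, C i) * ‖h‖ := by
  rw [Finset.sum_mul]
  refine (Finset.abs_sum_le_sum_abs _ _).trans (Finset.sum_le_sum fun i _ => ?_)
  rw [abs_mul, mul_comm]
  exact mul_le_mul (hr i) (PiLp.norm_apply_le h i) (abs_nonneg _) ((abs_nonneg _).trans (hr i))

/-- The Taylor bounds of orders one to three follow by applying the mean value inequality to the
remainder along the segment from `x` to `x + h`, whose derivative is controlled by the bound of the
previous order for the partial derivatives. -/
lemma exists_taylor₁ (f : 𝓢(E d, ℝ)) :
    ∃ C, 0 ≤ C ∧ ∀ x h : E d, |f (x + h) - f x| ≤ C * ‖h‖ := by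
  choose C hC0 hC using fun i => exists_schwartz_bound (schwartzD i f)
  refine ⟨∑ i, C i, Finset.sum_nonneg fun i _ => hC0 i, fun x h => ?_⟩
  have := norm_image_sub_le_of_norm_deriv_le_segment_01' (f := fun t : ℝ => f (x + t • h))
    (fun t _ => (hasDerivAt_schwartz_line f x h t).hasDerivWithinAt)
    (fun t _ => abs_sum_coord_mul_le h fun i => hC i (x + t • h))
  simpa using this

lemma exists_taylor₂ (f : 𝓢(E d, ℝ)) :
    ∃ C, 0 ≤ C ∧ ∀ x h : E d,
      |f (x + h) - f x - ∑ i, h i * schwartzD i f x| ≤ C * ‖h‖ ^ 2 := by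
  choose C hC0 hC using fun i => exists_taylor₁ (schwartzD i f)
  refine ⟨∑ i, C i, Finset.sum_nonneg fun i _ => hC0 i, fun x h => ?_⟩
  have key := norm_image_sub_le_of_norm_deriv_le_segment_01'
    (f := fun t : ℝ => f (x + t • h) - t * ∑ i, h i * schwartzD i f x)
    (f' := fun t => (∑ i, h i * schwartzD i f (x + t • h)) - ∑ i, h i * schwartzD i f x)
    (C := (∑ i, C i) * ‖h‖ ^ 2)
    (fun t _ => ((hasDerivAt_schwartz_line f x h t).sub
      (hasDerivAt_mul_const _)).hasDerivWithinAt)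
    (fun t ht => by
      rw [← Finset.sum_sub_distrib, Real.norm_eq_abs]
      simp only [← mul_sub]
      refine (abs_sum_coord_mul_le h (C := fun i => C i * ‖h‖) fun i => ?_).trans_eq ?_
      · refine (hC i x (t • h)).trans (mul_le_mul_of_nonneg_left ?_ (hC0 i))
        rw [norm_smul, Real.norm_eq_abs, abs_of_nonneg ht.1]
        exact mul_le_of_le_one_left (norm_nonneg _) ht.2.le
      · rw [← Finset.sum_mul]; ring)
  have e : f (x + h) - f x - ∑ i, h i * schwartzD i f x =
      f (x + (1 : ℝ) • h) - 1 * ∑ i, h i * schwartzD i f x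
        - (f (x + (0 : ℝ) • h) - 0 * ∑ i, h i * schwartzD i f x) := by
    simp only [one_smul, zero_smul, add_zero]; ring
  rw [e]
  exact key

lemma exists_taylor₃ (f : 𝓢(E d, ℝ)) :
    ∃ C, 0 ≤ C ∧ ∀ x h : E d,
      |f (x + h) - f x - ∑ i, h i * schwartzD i f x
        - 1 / 2 * ∑ j, h j * ∑ i, h i * schwartzD i (schwartzD j f) x| ≤ C * ‖h‖ ^ 3 := by
  choose C hC0 hC using fun i => exists_taylor₂ (schwartzD i f)
  refine ⟨∑ i, C i, Finset.sum_nonneg fun i _ => hC0 i, fun x h => ?_⟩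
  set A := ∑ i, h i * schwartzD i f x with hA
  set B := ∑ j, h j * ∑ i, h i * schwartzD i (schwartzD j f) x with hB
  have key := norm_image_sub_le_of_norm_deriv_le_segment_01'
    (f := fun t : ℝ => f (x + t • h) - t * A - t ^ 2 * (1 / 2 * B))
    (f' := fun t => (∑ i, h i * schwartzD i f (x + t • h)) - A - t * B)
    (C := (∑ i, C i) * ‖h‖ ^ 3)
    (fun t _ => by
      have h1 := ((hasDerivAt_schwartz_line f x h t).sub (hasDerivAt_mul_const (x := t) A)).sub
        ((hasDerivAt_pow 2 t).mul_const (1 / 2 * B))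
      refine (h1.congr_deriv ?_).hasDerivWithinAt
      push_cast
      ring)
    (fun t ht => by
      have e : (∑ i, h i * schwartzD i f (x + t • h)) - A - t * B =
          ∑ j, h j * (schwartzD j f (x + t • h) - schwartzD j f x
            - ∑ i, (t • h) i * schwartzD i (schwartzD j f) x) := by
        rw [hA, hB, Finset.mul_sum, ← Finset.sum_sub_distrib, ← Finset.sum_sub_distrib]
        refine Finset.sum_congr rfl fun j _ => ?_
        simp only [PiLp.smul_apply, smul_eq_mul, mul_assoc]
        rw [← Finset.mul_sum]
        ring
      rw [e, Real.norm_eq_abs]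
      refine (abs_sum_coord_mul_le h (C := fun i => C i * ‖h‖ ^ 2) fun i => ?_).trans_eq ?_
      · refine (hC i x (t • h)).trans (mul_le_mul_of_nonneg_left ?_ (hC0 i))
        rw [norm_smul, Real.norm_eq_abs, abs_of_nonneg ht.1]
        exact pow_le_pow_left₀ (mul_nonneg ht.1 (norm_nonneg _))
          (mul_le_of_le_one_left (norm_nonneg _) ht.2.le) 2
      · rw [← Finset.sum_mul]; ring)
  have e : f (x + h) - f x - A - 1 / 2 * B =
      f (x + (1 : ℝ) • h) - 1 * A - 1 ^ 2 * (1 / 2 * B)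
        - (f (x + (0 : ℝ) • h) - 0 * A - 0 ^ 2 * (1 / 2 * B)) := by
    simp only [one_smul, zero_smul, add_zero]; ring
  rw [e]
  exact key

/-! ### Expansion of the operator on corrected functions -/

/-- The rescaled operator in the microscopic variables `ξ = x / ε` and `η = y / ε`. -/
lemma L0_smul {ε : ℝ} (hε : 0 < ε) (u : E d → ℝ) {ξ : E d} (hξ : ξ ∈ Y) :
    L0 a Y ε u (ε • ξ) =
      (ε ^ 2)⁻¹ * ∫ η, a (ξ - η) * ind Y η * (u (ε • η) - u (ε • ξ)) := by
  have h := Measure.integral_comp_smul (volume : Measure (E d))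
    (fun y => a (ε⁻¹ • (ε • ξ - y)) * lam0 Y (ε⁻¹ • ε • ξ) (ε⁻¹ • y) * (u y - u (ε • ξ))) ε
  rw [finrank_euclideanSpace_fin, abs_of_pos (by positivity), smul_eq_mul] at h
  have e : ∀ η, a (ε⁻¹ • (ε • ξ - ε • η)) * lam0 Y (ε⁻¹ • ε • ξ) (ε⁻¹ • ε • η) *
      (u (ε • η) - u (ε • ξ)) = a (ξ - η) * ind Y η * (u (ε • η) - u (ε • ξ)) := by
    intro η
    rw [← smul_sub, inv_smul_smul₀ hε.ne', inv_smul_smul₀ hε.ne', inv_smul_smul₀ hε.ne', lam0]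
    simp [ind, hξ]
  simp only [e] at h
  rw [L0, h, pow_add]
  field_simp

section Expansion

variable {φ : E d → Fin d → ℝ} {ϰ : E d → Matrix (Fin d) (Fin d) ℝ}

/-- The first order coefficient in the expansion of the increments of `F^P_ε`. -/
def coeff₁ (φ : E d → Fin d → ℝ) (j : Fin d) (ξ η : E d) : ℝ := -(ξ - η) j + φ η j - φ ξ j

/-- The second order coefficient in the expansion of the increments of `F^P_ε`. -/
def coeff₂ (φ : E d → Fin d → ℝ) (ϰ : E d → Matrix (Fin d) (Fin d) ℝ) (i j : Fin d)
    (ξ η : E d) : ℝ :=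
  1 / 2 * ((ξ - η) i * (ξ - η) j) - (ξ - η) i * φ η j + ϰ η i j - ϰ ξ i j

/-- The expansion of the increments of `F^P_ε` up to second order in `ε`. -/
def mainPart (φ : E d → Fin d → ℝ) (ϰ : E d → Matrix (Fin d) (Fin d) ℝ) (f : 𝓢(E d, ℝ)) (ε : ℝ)
    (ξ η : E d) : ℝ :=
  ε * ∑ j, schwartzD j f (ε • ξ) * coeff₁ φ j ξ η
    + ε ^ 2 * ∑ j, ∑ i, schwartzD i (schwartzD j f) (ε • ξ) * coeff₂ φ ϰ i j ξ η

lemma FP_smul {ε : ℝ} (hε : 0 < ε) (f : 𝓢(E d, ℝ)) (ξ : E d) :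
    FP φ ϰ f ε (ε • ξ) = f (ε • ξ) + ε * ∑ j, φ ξ j * schwartzD j f (ε • ξ)
      + ε ^ 2 * ∑ j, ∑ i, ϰ ξ i j * schwartzD i (schwartzD j f) (ε • ξ) := by
  rw [FP, dotHess, inv_smul_smul₀ hε.ne', Finset.sum_comm]
  simp only [partialD_eq]

/-- The increment of `F^P_ε` minus its second order expansion is a sum of Taylor remainders. -/
lemma FP_sub_sub_mainPart {ε : ℝ} (hε : 0 < ε) (f : 𝓢(E d, ℝ)) (ξ η : E d) :
    FP φ ϰ f ε (ε • η) - FP φ ϰ f ε (ε • ξ) - mainPart φ ϰ f ε ξ η =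
      (f (ε • ξ + ε • (η - ξ)) - f (ε • ξ) - (∑ i, (ε • (η - ξ)) i * schwartzD i f (ε • ξ))
        - 1 / 2 * ∑ j, (ε • (η - ξ)) j *
          ∑ i, (ε • (η - ξ)) i * schwartzD i (schwartzD j f) (ε • ξ))
      + ε * (∑ j, φ η j * (schwartzD j f (ε • ξ + ε • (η - ξ)) - schwartzD j f (ε • ξ)
          - ∑ i, (ε • (η - ξ)) i * schwartzD i (schwartzD j f) (ε • ξ)))
      + ε ^ 2 * ∑ j, ∑ i, ϰ η i j * (schwartzD i (schwartzD j f) (ε • ξ + ε • (η - ξ))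
          - schwartzD i (schwartzD j f) (ε • ξ)) := by
  have hη : ε • ξ + ε • (η - ξ) = ε • η := by rw [← smul_add, add_sub_cancel]
  rw [hη, FP_smul hε, FP_smul hε, mainPart]
  have s1 : ε * ∑ j, φ η j * schwartzD j f (ε • η) - ε * ∑ j, φ ξ j * schwartzD j f (ε • ξ)
      - ε * ∑ j, schwartzD j f (ε • ξ) * coeff₁ φ j ξ η =
      -∑ j, (ε • (η - ξ)) j * schwartzD j f (ε • ξ)
        + ε * ∑ j, φ η j * (schwartzD j f (ε • η) - schwartzD j f (ε • ξ)) := by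
    simp only [Finset.mul_sum, ← Finset.sum_sub_distrib, ← Finset.sum_neg_distrib,
      ← Finset.sum_add_distrib]
    refine Finset.sum_congr rfl fun j _ => ?_
    simp only [coeff₁, PiLp.smul_apply, PiLp.sub_apply, smul_eq_mul]
    ring
  have s2 : ε ^ 2 * (∑ j, ∑ i, ϰ η i j * schwartzD i (schwartzD j f) (ε • η))
      - ε ^ 2 * (∑ j, ∑ i, ϰ ξ i j * schwartzD i (schwartzD j f) (ε • ξ))
      - ε ^ 2 * (∑ j, ∑ i, schwartzD i (schwartzD j f) (ε • ξ) * coeff₂ φ ϰ i j ξ η) =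
      -(1 / 2 * ∑ j, (ε • (η - ξ)) j *
          ∑ i, (ε • (η - ξ)) i * schwartzD i (schwartzD j f) (ε • ξ))
        - ε * (∑ j, φ η j * ∑ i, (ε • (η - ξ)) i * schwartzD i (schwartzD j f) (ε • ξ))
        + ε ^ 2 * ∑ j, ∑ i, ϰ η i j * (schwartzD i (schwartzD j f) (ε • η)
          - schwartzD i (schwartzD j f) (ε • ξ)) := by
    simp only [Finset.mul_sum, ← Finset.sum_sub_distrib, ← Finset.sum_neg_distrib,
      ← Finset.sum_add_distrib]
    refine Finset.sum_congr rfl fun j _ => Finset.sum_congr rfl fun i _ => ?_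
    simp only [coeff₂, PiLp.smul_apply, PiLp.sub_apply, smul_eq_mul]
    ring
  have s3 : ∑ j, φ η j * (schwartzD j f (ε • η) - schwartzD j f (ε • ξ)
        - ∑ i, (ε • (η - ξ)) i * schwartzD i (schwartzD j f) (ε • ξ)) =
      ∑ j, φ η j * (schwartzD j f (ε • η) - schwartzD j f (ε • ξ))
        - ∑ j, φ η j * ∑ i, (ε • (η - ξ)) i * schwartzD i (schwartzD j f) (ε • ξ) := by
    simp only [mul_sub _ (_ - _), Finset.sum_sub_distrib]
  rw [s3]
  linear_combination s1 + s2

lemma exists_FP_remainder_bound (hφ : ∀ j, IsBddPeriodic fun x => φ x j)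
    (hϰ : ∀ i j, IsBddPeriodic fun x => ϰ x i j) (f : 𝓢(E d, ℝ)) :
    ∃ M, 0 ≤ M ∧ ∀ ε : ℝ, 0 < ε → ∀ ξ η : E d,
      |FP φ ϰ f ε (ε • η) - FP φ ϰ f ε (ε • ξ) - mainPart φ ϰ f ε ξ η| ≤
        ε ^ 3 * M * (‖ξ - η‖ + ‖ξ - η‖ ^ 2 + ‖ξ - η‖ ^ 3) := by
  obtain ⟨C₃, hC₃, h3⟩ := exists_taylor₃ f
  choose C₂ hC₂ h2 using fun j => exists_taylor₂ (schwartzD j f)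
  choose C₁ hC₁ h1 using fun i j => exists_taylor₁ (schwartzD i (schwartzD j f))
  choose B hB using fun j => (hφ j).bounded
  choose K hK using fun i j => (hϰ i j).bounded
  have hB0 : ∀ j, 0 ≤ B j := fun j => (abs_nonneg _).trans (hB j 0)
  have hK0 : ∀ i j, 0 ≤ K i j := fun i j => (abs_nonneg _).trans (hK i j 0)
  have hS2 : 0 ≤ ∑ j, B j * C₂ j := Finset.sum_nonneg fun j _ => mul_nonneg (hB0 j) (hC₂ j)
  have hS1 : 0 ≤ ∑ j, ∑ i, K i j * C₁ i j := Finset.sum_nonneg fun j _ =>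
    Finset.sum_nonneg fun i _ => mul_nonneg (hK0 i j) (hC₁ i j)
  refine ⟨C₃ + (∑ j, B j * C₂ j) + ∑ j, ∑ i, K i j * C₁ i j, by positivity,
    fun ε hε ξ η => ?_⟩
  rw [FP_sub_sub_mainPart hε]
  set h := ε • (η - ξ) with hh
  have hn : ‖h‖ = ε * ‖ξ - η‖ := by
    rw [hh, norm_smul, Real.norm_eq_abs, abs_of_pos hε, norm_sub_rev]
  have b3 := h3 (ε • ξ) h
  have b2 : |∑ j, φ η j * (schwartzD j f (ε • ξ + h) - schwartzD j f (ε • ξ)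
          - ∑ i, h i * schwartzD i (schwartzD j f) (ε • ξ))| ≤ (∑ j, B j * C₂ j) * ‖h‖ ^ 2 := by
    rw [Finset.sum_mul]
    refine (Finset.abs_sum_le_sum_abs _ _).trans (Finset.sum_le_sum fun j _ => ?_)
    rw [abs_mul, mul_assoc]
    exact mul_le_mul (hB j η) (h2 j _ _) (abs_nonneg _) (hB0 j)
  have b1 : |∑ j, ∑ i, ϰ η i j * (schwartzD i (schwartzD j f) (ε • ξ + h)
          - schwartzD i (schwartzD j f) (ε • ξ))| ≤ (∑ j, ∑ i, K i j * C₁ i j) * ‖h‖ := by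
    rw [Finset.sum_mul]
    refine (Finset.abs_sum_le_sum_abs _ _).trans (Finset.sum_le_sum fun j _ => ?_)
    rw [Finset.sum_mul]
    refine (Finset.abs_sum_le_sum_abs _ _).trans (Finset.sum_le_sum fun i _ => ?_)
    rw [abs_mul, mul_assoc]
    exact mul_le_mul (hK i j η) (h1 i j _ _) (abs_nonneg _) (hK0 i j)
  rw [hn] at b1 b2 b3
  set z := ‖ξ - η‖ with hz
  have hz0 : 0 ≤ z := norm_nonneg _
  refine (abs_add_le _ _).trans ((add_le_add (abs_add_le _ _) le_rfl).trans ?_)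
  rw [abs_mul ε, abs_mul (ε ^ 2), abs_of_pos hε, abs_of_pos (pow_pos hε 2)]
  have b2' := mul_le_mul_of_nonneg_left b2 hε.le
  have b1' := mul_le_mul_of_nonneg_left b1 (pow_pos hε 2).le
  refine (add_le_add (add_le_add b3 b2') b1').trans ?_
  have q : 0 ≤ C₃ * (z + z ^ 2) + (∑ j, B j * C₂ j) * (z + z ^ 3)
      + (∑ j, ∑ i, K i j * C₁ i j) * (z ^ 2 + z ^ 3) := by positivity
  have q' := mul_nonneg (pow_pos hε 3).le q
  linarith

/-- By the cell problems, the first order term of the expansion integrates to zero and the second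
order term to the contraction of the effective matrix with the Hessian. -/
lemma integral_mainPart (ha : IsKernel a) (hYp : PeriodicSet Y) (hYo : IsOpen Y)
    (hφ : IsFirstCorrector a Y φ) (hϰ : ∀ i j, IsBddPeriodic fun x => ϰ x i j)
    (hϰY : ∀ i j x, ind Y x * ϰ x i j = ϰ x i j)
    (hϰs : ∀ i j, ∀ ξ ∈ Y, conv a (fun x => ϰ x i j) ξ - conv a (ind Y) ξ * ϰ ξ i j =
        effMatrix a Y φ i j - effDensity a Y φ i j ξ)
    (f : 𝓢(E d, ℝ)) (ε : ℝ) {ξ : E d} (hξ : ξ ∈ Y) :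
    Integrable (fun η => a (ξ - η) * ind Y η * mainPart φ ϰ f ε ξ η) ∧
      ∫ η, a (ξ - η) * ind Y η * mainPart φ ϰ f ε ξ η =
        ε ^ 2 * dotHess (effMatrix a Y φ) f (ε • ξ) := by
  have hY := isBddPeriodic_ind hYp hYo.measurableSet
  have j1 : ∀ j, Integrable (fun η => a (ξ - η) * ind Y η * coeff₁ φ j ξ η) ∧
      ∫ η, a (ξ - η) * ind Y η * coeff₁ φ j ξ η = 0 := by
    intro j
    have i1 := integrable_conv (integrable_kernel₁ ha j) hY ξ
    have i2 := integrable_conv ha.integrable (hφ.bddPeriodic j) ξ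
    have i3 := (integrable_conv ha.integrable hY ξ).const_mul (φ ξ j)
    have e : (fun η => a (ξ - η) * ind Y η * coeff₁ φ j ξ η) =
        (fun η => a (ξ - η) * φ η j) - (fun η => kernel₁ a j (ξ - η) * ind Y η)
          - fun η => φ ξ j * (a (ξ - η) * ind Y η) := by
      ext η
      simp only [coeff₁, kernel₁, Pi.sub_apply]
      linear_combination a (ξ - η) * hφ.ind_mul j η
    refine ⟨e ▸ (i2.sub i1).sub i3, ?_⟩
    rw [e, integral_sub' (i2.sub i1) i3, integral_sub' i2 i1, integral_const_mul]
    have := hφ.solves j ξ hξ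
    simp only [conv] at this
    linarith
  have j2 : ∀ i j, Integrable (fun η => a (ξ - η) * ind Y η * coeff₂ φ ϰ i j ξ η) ∧
      ∫ η, a (ξ - η) * ind Y η * coeff₂ φ ϰ i j ξ η = effMatrix a Y φ i j := by
    intro i j
    have i1 := (integrable_conv (integrable_kernel₂ ha i j) hY ξ).const_mul (1 / 2)
    have i2 := integrable_conv (integrable_kernel₁ ha i) (hφ.bddPeriodic j) ξ
    have i3 := integrable_conv ha.integrable (hϰ i j) ξ
    have i4 := (integrable_conv ha.integrable hY ξ).const_mul (ϰ ξ i j)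
    have e : (fun η => a (ξ - η) * ind Y η * coeff₂ φ ϰ i j ξ η) =
        (fun η => 1 / 2 * (kernel₂ a i j (ξ - η) * ind Y η))
          - (fun η => kernel₁ a i (ξ - η) * φ η j) + (fun η => a (ξ - η) * ϰ η i j)
          - fun η => ϰ ξ i j * (a (ξ - η) * ind Y η) := by
      ext η
      simp only [coeff₂, kernel₁, kernel₂, Pi.sub_apply, Pi.add_apply]
      linear_combination (-a (ξ - η) * (ξ - η) i) * hφ.ind_mul j η + a (ξ - η) * hϰY i j η
    refine ⟨e ▸ ((i1.sub i2).add i3).sub i4, ?_⟩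
    rw [e, integral_sub' ((i1.sub i2).add i3) i4, integral_add' (i1.sub i2) i3,
      integral_sub' i1 i2, integral_const_mul, integral_const_mul]
    have := hϰs i j ξ hξ
    simp only [conv, effDensity] at this
    linarith
  have e : (fun η => a (ξ - η) * ind Y η * mainPart φ ϰ f ε ξ η) = fun η =>
      (∑ j, ε * schwartzD j f (ε • ξ) * (a (ξ - η) * ind Y η * coeff₁ φ j ξ η))
      + ∑ j, ∑ i, ε ^ 2 * schwartzD i (schwartzD j f) (ε • ξ) *
          (a (ξ - η) * ind Y η * coeff₂ φ ϰ i j ξ η) := by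
    ext η
    rw [mainPart, mul_add]
    simp only [Finset.mul_sum]
    congr 1
    · exact Finset.sum_congr rfl fun j _ => by ring
    · exact Finset.sum_congr rfl fun j _ => Finset.sum_congr rfl fun i _ => by ring
  have k1 := fun j => (j1 j).1.const_mul (ε * schwartzD j f (ε • ξ))
  have k2 := fun j i => (j2 i j).1.const_mul (ε ^ 2 * schwartzD i (schwartzD j f) (ε • ξ))
  have l1 := integrable_finsetSum Finset.univ fun j _ => k1 j
  have l2 := integrable_finsetSum Finset.univ fun j _ =>
    integrable_finsetSum Finset.univ fun i _ => k2 j i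
  refine ⟨e ▸ l1.add l2, ?_⟩
  rw [e, integral_add l1 l2, integral_finsetSum _ fun j _ => k1 j,
    integral_finsetSum _ fun j _ => integrable_finsetSum Finset.univ fun i _ => k2 j i]
  simp_rw [integral_finsetSum _ fun i _ => k2 _ i, integral_const_mul, (j1 _).2, (j2 _ _).2]
  rw [dotHess, Finset.sum_comm, Finset.mul_sum]
  simp only [mul_zero, Finset.sum_const_zero, zero_add, Finset.mul_sum, partialD_eq]
  exact Finset.sum_congr rfl fun j _ => Finset.sum_congr rfl fun i _ => by ring

/-- The operator applied to the corrected function differs from the effective one by `O(ε)`,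
uniformly on the rescaled set. -/
theorem exists_abs_L0_FP_sub_le (ha : IsKernel a) (hYp : PeriodicSet Y) (hYo : IsOpen Y)
    (hφ : IsFirstCorrector a Y φ) (hϰ : ∀ i j, IsBddPeriodic fun x => ϰ x i j)
    (hϰY : ∀ i j x, ind Y x * ϰ x i j = ϰ x i j)
    (hϰs : ∀ i j, ∀ ξ ∈ Y, conv a (fun x => ϰ x i j) ξ - conv a (ind Y) ξ * ϰ ξ i j =
        effMatrix a Y φ i j - effDensity a Y φ i j ξ)
    (f : 𝓢(E d, ℝ)) :
    ∃ C : ℝ, ∀ ε : ℝ, 0 < ε → ∀ ξ ∈ Y,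
      |L0 a Y ε (FP φ ϰ f ε) (ε • ξ) - dotHess (effMatrix a Y φ) f (ε • ξ)| ≤ C * ε := by
  have hY := isBddPeriodic_ind hYp hYo.measurableSet
  obtain ⟨M, hM, hrem⟩ := exists_FP_remainder_bound hφ.bddPeriodic hϰ f
  set g : E d → ℝ := fun z => (‖z‖ + ‖z‖ ^ 2 + ‖z‖ ^ 3) * a z with hg
  have hgi : Integrable g := by
    have := ((ha.integrable_pow (k := 1) (by norm_num)).add
      (ha.integrable_pow (k := 2) (by norm_num))).add ha.third_moment
    refine this.congr (ae_of_all _ fun z => ?_)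
    simp only [hg, Pi.add_apply]
    ring
  refine ⟨M * ∫ z, g z, fun ε hε ξ hξ => ?_⟩
  obtain ⟨hmi, hme⟩ := integral_mainPart ha hYp hYo hφ hϰ hϰY hϰs f ε hξ
  set Δ : E d → ℝ := fun η => FP φ ϰ f ε (ε • η) - FP φ ϰ f ε (ε • ξ) with hΔ
  set R : E d → ℝ := fun η => a (ξ - η) * ind Y η * (Δ η - mainPart φ ϰ f ε ξ η) with hR
  have hRb : ∀ η, ‖R η‖ ≤ ε ^ 3 * M * g (ξ - η) := by
    intro η
    have h0 := ha.nonneg (ξ - η)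
    have h1 : 0 ≤ ind Y η := ind_nonneg Y η
    have h2 : ind Y η ≤ 1 := Set.indicator_le_self' (fun _ _ => zero_le_one) η
    rw [Real.norm_eq_abs, hR]
    simp only
    rw [abs_mul, abs_mul, abs_of_nonneg h0, abs_of_nonneg h1]
    have := hrem ε hε ξ η
    calc a (ξ - η) * ind Y η * |Δ η - mainPart φ ϰ f ε ξ η|
        ≤ a (ξ - η) * 1 * (ε ^ 3 * M * (‖ξ - η‖ + ‖ξ - η‖ ^ 2 + ‖ξ - η‖ ^ 3)) := by gcongr
      _ = _ := by simp only [hg]; ring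
  have hbi : Integrable fun η => ε ^ 3 * M * g (ξ - η) := (hgi.comp_sub_left ξ).const_mul _
  have hfm : ∀ h : 𝓢(E d, ℝ), Measurable fun η : E d => h (ε • η) := fun h =>
    (h.continuous.comp (continuous_const_smul ε)).measurable
  have hΔm : Measurable Δ := by
    simp only [hΔ, FP_smul hε]
    refine Measurable.sub_const ?_ _
    refine ((hfm f).add (Measurable.const_mul (Finset.measurable_fun_sum _ fun j _ =>
      (hφ.bddPeriodic j).measurable.mul (hfm _)) _)).add
      (Measurable.const_mul (Finset.measurable_fun_sum _ fun j _ =>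
        Finset.measurable_fun_sum _ fun i _ => (hϰ i j).measurable.mul (hfm _)) _)
  have hR' : R = (fun η => a (ξ - η) * ind Y η * Δ η) -
      fun η => a (ξ - η) * ind Y η * mainPart φ ϰ f ε ξ η := by
    ext η; simp only [hR, Pi.sub_apply]; ring
  have hRi : Integrable R := by
    refine hbi.mono' ?_ (ae_of_all _ hRb)
    rw [hR']
    exact (((integrable_conv ha.integrable hY ξ).aestronglyMeasurable).mul
      hΔm.aestronglyMeasurable).sub hmi.aestronglyMeasurable
  have hsum : ∫ η, a (ξ - η) * ind Y η * Δ η =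
      (∫ η, R η) + ∫ η, a (ξ - η) * ind Y η * mainPart φ ϰ f ε ξ η := by
    rw [← integral_add hRi hmi]
    congr 1; ext η
    simp only [hR]; ring
  have hfin : |∫ η, R η| ≤ ε ^ 3 * M * ∫ z, g z := by
    have := norm_integral_le_of_norm_le hbi (ae_of_all _ hRb)
    rwa [integral_const_mul, integral_sub_left_eq_self g volume ξ] at this
  rw [L0_smul hε _ hξ, hsum, hme]
  have e : (ε ^ 2)⁻¹ * ((∫ η, R η) + ε ^ 2 * dotHess (effMatrix a Y φ) f (ε • ξ))
      - dotHess (effMatrix a Y φ) f (ε • ξ) = (ε ^ 2)⁻¹ * ∫ η, R η := by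
    field_simp
    ring
  rw [e, abs_mul, abs_of_pos (by positivity), inv_mul_le_iff₀ (by positivity)]
  calc _ ≤ _ := hfin
    _ = _ := by ring

end Expansion

end NonlocalPorosity

end

theorem mainTheorem5 {d : ℕ} (a : NonlocalPorosity.E d → ℝ) (G Y : Set (NonlocalPorosity.E d))
    (ha : NonlocalPorosity.IsKernel a) (hGY : NonlocalPorosity.IsGeometry a G Y) :
    ∃ (φ : NonlocalPorosity.E d → Fin d → ℝ)
      (ϰ : NonlocalPorosity.E d → Matrix (Fin d) (Fin d) ℝ)
      (Θ : Matrix (Fin d) (Fin d) ℝ),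
      (∀ i, NonlocalPorosity.IsCorrector Y (fun ξ => φ ξ i)) ∧
      (∀ i j, NonlocalPorosity.IsCorrector Y (fun ξ => ϰ ξ i j)) ∧
      -- the cell problem for `φ`
      (∀ i, ∀ ξ ∈ Y, NonlocalPorosity.cellOp a Y (fun η => φ η i) ξ =
        -∫ η in Y, a (ξ - η) * (η - ξ) i) ∧
      -- the cell problem for `ϰ`
      (∀ i j, ∀ ξ ∈ Y, NonlocalPorosity.cellOp a Y (fun η => ϰ η i j) ξ =
        Θ i j - ∫ η in Y, NonlocalPorosity.effIntegrand a φ i j ξ η) ∧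
      -- the cell formula for `Θ`
      (∀ i j, volume.real (Y ∩ NonlocalPorosity.unitCell d) * Θ i j =
        ∫ ξ in Y, ∫ η in Y ∩ NonlocalPorosity.unitCell d,
          NonlocalPorosity.effIntegrand a φ i j ξ η) ∧
      Θ.PosDef ∧
      ∀ f₀ : 𝓢(NonlocalPorosity.E d, ℝ),
        Tendsto
          (fun ε : ℝ => ⨆ x ∈ {x : NonlocalPorosity.E d | ε⁻¹ • x ∈ Y},
            ENNReal.ofReal
              |NonlocalPorosity.L0 a Y ε (NonlocalPorosity.FP φ ϰ f₀ ε) x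
                - NonlocalPorosity.dotHess Θ f₀ x|)
          (𝓝[>] (0 : ℝ)) (𝓝 0) := by
  have hYp := hGY.periodic_Y
  have hYo := hGY.isOpen_Y
  have hYn := hGY.nonempty_Y
  have hconn := hGY.connected
  obtain ⟨φ, hφ⟩ := NonlocalPorosity.exists_isFirstCorrector ha hYp hYo hYn hconn
  obtain ⟨ϰ, hϰ⟩ := NonlocalPorosity.exists_secondCorrector ha hYp hYo hYn hconn hφ
  refine ⟨φ, ϰ, NonlocalPorosity.effMatrix a Y φ, fun i => ?_, fun i j => ?_, fun i ξ hξ => ?_,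
    fun i j ξ hξ => ?_, fun i j => ?_,
    NonlocalPorosity.posDef_effMatrix ha hYp hYo hYn hconn hφ, fun f₀ => ?_⟩
  · obtain ⟨C, hC⟩ := (hφ.bddPeriodic i).bounded
    exact ⟨(hφ.bddPeriodic i).periodic, hφ.continuousOn i, C, fun ξ _ => hC ξ⟩
  · obtain ⟨hb, -, hc, -⟩ := hϰ i j
    obtain ⟨C, hC⟩ := hb.bounded
    exact ⟨hb.periodic, hc, C, fun ξ _ => hC ξ⟩
  · rw [NonlocalPorosity.cellOp_eq ha hYp hYo (hφ.bddPeriodic i) (hφ.ind_mul i),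
      NonlocalPorosity.setIntegral_firstMoment hYo]
    exact hφ.solves i ξ hξ
  · obtain ⟨hb, hi, -, hs⟩ := hϰ i j
    rw [NonlocalPorosity.cellOp_eq ha hYp hYo hb hi,
      NonlocalPorosity.setIntegral_effIntegrand ha hYp hYo hφ]
    exact hs ξ hξ
  · rw [NonlocalPorosity.volume_mul_effMatrix hYp hYo hYn,
      NonlocalPorosity.integral_setIntegral_effIntegrand ha hYp hYo hφ]
  · obtain ⟨C, hC⟩ := NonlocalPorosity.exists_abs_L0_FP_sub_le ha hYp hYo hφ
      (fun i j => (hϰ i j).1) (fun i j => (hϰ i j).2.1) (fun i j => (hϰ i j).2.2.2) f₀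
    have hlim : Tendsto (fun ε : ℝ => ENNReal.ofReal (C * ε)) (𝓝[>] 0) (𝓝 0) := by
      have hcont : Continuous fun ε : ℝ => ENNReal.ofReal (C * ε) :=
        ENNReal.continuous_ofReal.comp (by fun_prop)
      have := hcont.tendsto 0
      rw [mul_zero, ENNReal.ofReal_zero] at this
      exact this.mono_left nhdsWithin_le_nhds
    refine tendsto_of_tendsto_of_tendsto_of_le_of_le' tendsto_const_nhds hlim
      (Eventually.of_forall fun _ => zero_le) ?_
    filter_upwards [self_mem_nhdsWithin] with ε hε
    have hε' : 0 < ε := hε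
    refine iSup₂_le fun x hx => ENNReal.ofReal_le_ofReal ?_
    have := hC ε hε' _ hx
    rwa [smul_inv_smul₀ hε'.ne'] at this
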